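/- Let $N\ge 1$ and let $\mathcal H=\{v\in\mathbb R^N:\sum_{n=1}^N v_n=0\}$ with the Euclidean inner product. For $q=(x,b)\in\mathcal H^2=\mathcal H\oplus\mathcal H$ put $a_n=e^{x_n}$ and extend $a_n,b_n$ to $N$-periodic sequences over $\mathbb Z$. Let $\varphi=\varphi(\lambda,q)$ and $\vartheta=\vartheta(\lambda,q)$ be the solutions of $$a_{n-1}y_{n-1}+b_ny_n+a_ny_{n+1}=\lambda y_n$$ with $\varphi_0=\vartheta_1=0$, $\varphi_1=\vartheta_0=1$, and let $\Delta(\lambda)=\tfrac12(\varphi_{N+1}(\lambda)+\vartheta_N(\lambda))$. Let $\lambda_0^+<\lambda_1^-\le\lambda_1^+<\dots<\lambda_{N-1}^-\le\lambda_{N-1}^+<\lambda_N^-$ be the roots of $\Delta^2=1$ counted with multiplicity. For $1\le n\le N-1$ let $\lambda_n$ be the point $t\in[\lambda_n^-,\lambda_n^+]$ with $\Delta'(t)=0$, $\Delta''(t)\ne0$ and $(-1)^{N-n}\Delta(t)\ge1$, and let $\nu_1<\dots<\nu_{N-1}$ be the zeros of $\varphi_N$ (the Dirichlet eigenvalues).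 Define $|\psi_n|\ge0$ by $$\cosh|\psi_n|=(-1)^{N-n}\Delta(\lambda_n),$$ and let $\psi_n=(\psi_{1,n},\psi_{2,n})\in\mathbb R^2$, where $$\psi_{1,n}=\log\big((-1)^{N-n}\varphi_{N+1}(\nu_n)\big),\qquad \psi_{2,n}=\big(|\psi_n|^2-\psi_{1,n}^2\big)^{1/2}\,\mathrm{sign}(\lambda_n-\nu_n).$$ **Theorem 1.1.** For every $q\in\mathcal H^2$ these quantities are well defined: $\varphi_N$ has exactly $N-1$ distinct real zeros, there is exactly one such point $\lambda_n$ for each $n$, the argument of the logarithm is positive, $|\psi_n|^2-\psi_{1,n}^2\ge0$, and the Euclidean norm of the vector $\psi_n$ is the number $|\psi_n|$, i.e. $\cosh\sqrt{\psi_{1,n}^2+\psi_{2,n}^2}=(-1)^{N-n}\Delta(\lambda_n)$. The Marchenko–Ostrovsky map $$\psi=(\psi_n)_{n=1}^{N-1}:\mathcal H^2\to\mathbb R^{2N-2}$$ is a real analytic isomorphism: it is bijective, and both $\psi$ and $\psi^{-1}$ are real analytic. -/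

import Mathlib

open Polynomial

noncomputable section

/-- The Hilbert space `ℋ` of real `N`-periodic sequences (functions on `ℤ/Nℤ`, with the Euclidean
inner product of `ℝ^N`) whose sum over one period is zero. -/
def MeanZeroSeq (N : ℕ) [NeZero N] : Submodule ℝ (EuclideanSpace ℝ (ZMod N)) where
  carrier := {v | ∑ n : ZMod N, v n = 0}
  zero_mem' := by simp
  add_mem' := by
    intro v w hv hw
    simp only [Set.mem_ofPred_eq] at hv hw ⊢
    simp [Finset.sum_add_distrib, hv, hw]
  smul_mem' := by
    intro c v hv
    simp only [Set.mem_ofPred_eq] at hv ⊢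
    simp [← Finset.mul_sum, hv]

/-- The Hilbert space `ℋ² = ℋ ⊕ ℋ` of `N`-periodic Jacobi data `q = (x, b)`. -/
abbrev JacobiData (N : ℕ) [NeZero N] : Type :=
  WithLp 2 (MeanZeroSeq N × MeanZeroSeq N)

/-- The target space `ℝ^{2N-2}`, written as the Hilbert sum of `N - 1` copies of `ℝ²`.
The index `n : Fin (N - 1)` stands for `n + 1 ∈ {1, …, N - 1}`. -/
abbrev MOTarget (N : ℕ) : Type :=
  PiLp 2 (fun _ : Fin (N - 1) => EuclideanSpace ℝ (Fin 2))

/-- A map of Hilbert spaces is a real analytic isomorphism if it is bijective and both it and its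
inverse are real analytic. -/
def IsRealAnalyticIsomorphism {E F : Type*} [NormedAddCommGroup E] [InnerProductSpace ℝ E]
    [NormedAddCommGroup F] [InnerProductSpace ℝ F] (f : E → F) : Prop :=
  ∃ e : E ≃ F, (∀ q, e q = f q) ∧
    AnalyticOnNhd ℝ e Set.univ ∧ AnalyticOnNhd ℝ e.symm Set.univ

/-- The `k`-th (`k = 0, 1, …`) real root of a polynomial, the real roots being listed in
increasing order and repeated according to multiplicity. -/
def sortedRoot (p : ℝ[X]) (k : ℕ) : ℝ :=
  (p.roots.sort (· ≤ ·)).getD k 0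

namespace JacobiData

variable {N : ℕ} [NeZero N]

/-- The coefficients `a_n = exp x_n`, `n ∈ ℤ/Nℤ`. -/
def a (q : JacobiData N) (n : ZMod N) : ℝ :=
  Real.exp ((q.fst : EuclideanSpace ℝ (ZMod N)) n)

/-- The coefficients `b_n`, `n ∈ ℤ/Nℤ`. -/
def b (q : JacobiData N) (n : ZMod N) : ℝ :=
  (q.snd : EuclideanSpace ℝ (ZMod N)) n

/-- The solution `(y_n)_{n ≥ 0}` of `a_{n-1} y_{n-1} + b_n y_n + a_n y_{n+1} = λ y_n` with
prescribed `y_0` and `y_1`; each `y_n` is a polynomial in the spectral parameter `λ = X`. -/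
def solution (q : JacobiData N) (y₀ y₁ : ℝ[X]) : ℕ → ℝ[X]
  | 0 => y₀
  | 1 => y₁
  | n + 2 => C ((q.a (n + 1 : ℕ))⁻¹) *
      ((X - C (q.b (n + 1 : ℕ))) * solution q y₀ y₁ (n + 1) - C (q.a n) * solution q y₀ y₁ n)

/-- The fundamental solution `φ` with `φ_0 = 0`, `φ_1 = 1`. -/
def phi (q : JacobiData N) (n : ℕ) : ℝ[X] := q.solution 0 1 n

/-- The fundamental solution `ϑ` with `ϑ_0 = 1`, `ϑ_1 = 0`. -/
def theta (q : JacobiData N) (n : ℕ) : ℝ[X] := q.solution 1 0 n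

/-- The Lyapunov function `Δ = (φ_{N+1} + ϑ_N) / 2`. -/
def lyapunov (q : JacobiData N) : ℝ[X] :=
  C (1 / 2 : ℝ) * (q.phi (N + 1) + q.theta N)

/-- The edges of the spectral bands: the roots of `Δ² - 1` in increasing order, with multiplicity,
`λ_0⁺ < λ_1⁻ ≤ λ_1⁺ < ⋯ < λ_{N-1}⁻ ≤ λ_{N-1}⁺ < λ_N⁻`. -/
def bandEdge (q : JacobiData N) (k : ℕ) : ℝ := sortedRoot (q.lyapunov ^ 2 - 1) k

/-- The lower end `λ_n⁻` of the `n`-th gap. -/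
def gapLeft (q : JacobiData N) (n : ℕ) : ℝ := q.bandEdge (2 * n - 1)

/-- The upper end `λ_n⁺` of the `n`-th gap. -/
def gapRight (q : JacobiData N) (n : ℕ) : ℝ := q.bandEdge (2 * n)

/-- The sign `(-1)^{N-n}`, where `n : Fin (N - 1)` stands for `n + 1 ∈ {1, …, N - 1}`. -/
def gapSign (n : Fin (N - 1)) : ℝ := (-1) ^ (N - (n.val + 1))

/-- `t` is the critical point of `Δ` in the `n`-th closed gap. -/
def IsGapCriticalPoint (q : JacobiData N) (n : Fin (N - 1)) (t : ℝ) : Prop :=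
  t ∈ Set.Icc (q.gapLeft (n.val + 1)) (q.gapRight (n.val + 1)) ∧
    (derivative q.lyapunov).eval t = 0 ∧
    (derivative (derivative q.lyapunov)).eval t ≠ 0 ∧
    1 ≤ gapSign n * q.lyapunov.eval t

/-- The critical point `λ_n` of `Δ` in the `n`-th closed gap. -/
def criticalPoint (q : JacobiData N) (n : Fin (N - 1)) : ℝ :=
  Classical.epsilon (q.IsGapCriticalPoint n)

/-- The Dirichlet eigenvalues `ν_1 < ⋯ < ν_{N-1}`: the zeros of `φ_N` in increasing order. -/
def dirichletEigenvalue (q : JacobiData N) (n : Fin (N - 1)) : ℝ :=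
  sortedRoot (q.phi N) n.val

/-- The norming constant `ψ_{1,n} = log ((-1)^{N-n} φ_{N+1}(ν_n))`. -/
def normingConstant (q : JacobiData N) (n : Fin (N - 1)) : ℝ :=
  Real.log (gapSign n * (q.phi (N + 1)).eval (q.dirichletEigenvalue n))

/-- The height `|ψ_n| ≥ 0`, determined by `cosh |ψ_n| = (-1)^{N-n} Δ(λ_n)`. -/
def slitHeight (q : JacobiData N) (n : Fin (N - 1)) : ℝ :=
  Real.arcosh (gapSign n * q.lyapunov.eval (q.criticalPoint n))

/-- The signed remainder `ψ_{2,n} = (|ψ_n|² - ψ_{1,n}²)^{1/2} sign (λ_n - ν_n)`. -/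
def signedRemainder (q : JacobiData N) (n : Fin (N - 1)) : ℝ :=
  √(q.slitHeight n ^ 2 - q.normingConstant n ^ 2) *
    Real.sign (q.criticalPoint n - q.dirichletEigenvalue n)

/-- The Marchenko–Ostrovsky map `ψ = (ψ_{1,n}, ψ_{2,n})_n`. -/
def marchenkoOstrovsky (q : JacobiData N) : MOTarget N :=
  WithLp.toLp 2 fun n => !₂[q.normingConstant n, q.signedRemainder n]

end JacobiData

end

/-! Write `N = m + 1`. Source and target both have dimension `2m`, and `ψ` is shown to be analytic,
with injective derivative everywhere, and proper. It is therefore a proper local homeomorphism with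
locally analytic inverses, and it is bijective as soon as one fibre has at most one point
(`isRealAnalyticIsomorphism_of_proper`). The fibre used is the one over `0`.

Well-definedness. The Wronskian gives `φ_{N+1} ϑ_N = 1` at each `ν_n`, so `(-1)^{N-n} Δ(ν_n) = cosh
ψ_{1,n} ≥ 1`. This alternation alone forces the whole band picture (`exists_isBandStructure`).

Analyticity. `arcosh²` continues analytically through `1` with positive derivative, and `(-1)^{N-n}
(Δ(λ_n) - Δ(ν_n))` is `(λ_n - ν_n)²` times a positive analytic function. Hence `ψ_{2,n}` is locally
`λ_n - ν_n` times a positive analytic function (`exists_signedRemainder_eq`).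

Derivative. Along a direction killed by `dψ` the heights are stationary, so the variation of `Δ`
vanishes at the `m` points `λ_n`. The normalisations of `x` and `b` fix the two leading coefficients
of `Δ`, so this variation is zero. Then the `ν_n` are stationary, hence so are the monic multiple of
`φ_N` and `φ_{N+1}`, and descending the recurrence kills the direction
(`eq_zero_of_fderiv_eq_zero`).

Fibre over `0`. All gaps are closed and `Δ` equioscillates. A Chebyshev-type argument determines it,
and then `ν_n = λ_n` and `ψ_{1,n} = 0` determine `q` (`eq_of_marchenkoOstrovsky_eq_zero`).

Properness. Bounded heights bound `Δ` between its outermost edges, hence the length of that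
interval, the zeros of `Δ`, and through one coefficient of `Δ` the sum `∑ b² / 2 + ∑ a²`. Since `∑ x
= 0`, this bounds `x` on both sides (`exists_norm_bound`). -/

/-! ### Real polynomials: sign alternation, interlacing and sorted roots. -/

theorem Polynomial.eq_zero_of_coeff_of_eval {p : ℝ[X]} {m : ℕ} {y : ℕ → ℝ}
    (hy : StrictMonoOn y (Set.Iio m)) (hp : ∀ k, m ≤ k → p.coeff k = 0)
    (h0 : ∀ k < m, p.eval (y k) = 0) : p = 0 := by
  refine eq_zero_of_degree_lt_of_eval_index_eq_zero (Finset.range m) (v := y) ?_ ?_ ?_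
  · simpa using hy.injOn
  · rw [Finset.card_range, degree_lt_iff_coeff_zero]
    exact fun k hk => hp k (by exact_mod_cast hk)
  · simpa using h0

theorem Polynomial.eq_C_mul_prod_of_eval {p : ℝ[X]} {m : ℕ} {y : ℕ → ℝ}
    (hy : StrictMonoOn y (Set.Iio m)) (hp : p.natDegree ≤ m)
    (h0 : ∀ k < m, p.eval (y k) = 0) :
    p = C (p.coeff m) * ∏ j ∈ Finset.range m, (X - C (y j)) := by
  have hmon : (∏ j ∈ Finset.range m, (X - C (y j))).Monic := monic_prod_X_sub_C _ _
  have hdeg : (∏ j ∈ Finset.range m, (X - C (y j))).natDegree = m := by simp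
  rw [← sub_eq_zero]
  refine eq_zero_of_coeff_of_eval hy (fun k hk => ?_) fun k hk => ?_
  · rw [coeff_sub, coeff_C_mul]
    rcases hk.eq_or_lt with rfl | hk
    · have := hmon.coeff_natDegree
      rw [hdeg] at this
      rw [this, mul_one, sub_self]
    · rw [coeff_eq_zero_of_natDegree_lt (hp.trans_lt hk),
        coeff_eq_zero_of_natDegree_lt (hdeg.trans_lt hk)]
      simp
  · rw [eval_sub, h0 k hk, eval_mul, eval_prod,
      Finset.prod_eq_zero (Finset.mem_range.2 hk) (by simp)]
    simp

/-- Exactly `m - k` of the factors are negative. -/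
theorem neg_one_pow_mul_prod_sub_pos {m k : ℕ} {y : ℕ → ℝ} {t : ℝ} (hkm : k ≤ m)
    (h1 : ∀ j < k, y j < t) (h2 : ∀ j, k ≤ j → j < m → t < y j) :
    0 < (-1 : ℝ) ^ (m - k) * ∏ j ∈ Finset.range m, (t - y j) := by
  induction m, hkm using Nat.le_induction with
  | base =>
    simpa using Finset.prod_pos fun j hj => sub_pos.2 (h1 j (Finset.mem_range.1 hj))
  | succ m hm ih =>
    have := ih fun j hj hjm => h2 j hj (by omega)
    rw [Finset.prod_range_succ, Nat.succ_sub hm, pow_succ]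
    have h3 : 0 < y m - t := sub_pos.2 (h2 m hm (by omega))
    nlinarith [mul_pos this h3]

theorem Polynomial.exists_gt_eval_ge {p : ℝ[X]} (hp : 0 < p.natDegree) (hl : 0 < p.leadingCoeff)
    (M c : ℝ) : ∃ B, M < B ∧ c ≤ p.eval B := by
  have h := p.tendsto_atTop_of_leadingCoeff_nonneg (natDegree_pos_iff_degree_pos.1 hp) hl.le
  obtain ⟨B, h1, h2⟩ := ((Filter.eventually_gt_atTop M).and (h.eventually_ge_atTop c)).exists
  exact ⟨B, h1, h2⟩

theorem Polynomial.exists_lt_eval_ge {p : ℝ[X]} (hp : 0 < p.natDegree) (hl : 0 < p.leadingCoeff)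
    (M c : ℝ) : ∃ A, A < M ∧ c ≤ (-1) ^ p.natDegree * p.eval A := by
  -- The reflection `t ↦ -t`, with the sign that keeps the leading coefficient positive.
  set q : ℝ[X] := C ((-1) ^ p.natDegree) * p.comp (-X)
  have hne : ((-1 : ℝ) ^ p.natDegree) ≠ 0 := by simp
  have hq : q.natDegree = p.natDegree := by
    rw [natDegree_C_mul hne, natDegree_comp, natDegree_neg, natDegree_X, mul_one]
  have hql : q.leadingCoeff = p.leadingCoeff := by
    rw [leadingCoeff_mul, leadingCoeff_C, leadingCoeff_comp (by simp), leadingCoeff_neg,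
      leadingCoeff_X, mul_left_comm, ← mul_pow]
    simp
  obtain ⟨B, h1, h2⟩ := exists_gt_eval_ge (hq ▸ hp) (hql ▸ hl) (-M) c
  refine ⟨-B, by linarith, ?_⟩
  simpa [q, eval_comp] using h2

theorem Polynomial.exists_root_mem_Ioo (p : ℝ[X]) {a b s : ℝ} (hab : a < b)
    (ha : s * p.eval a < 0) (hb : 0 < s * p.eval b) : ∃ t, a < t ∧ t < b ∧ p.eval t = 0 := by
  have hc : ContinuousOn (fun t => s * p.eval t) (Set.Icc a b) := by fun_prop
  obtain ⟨t, ht, h⟩ := intermediate_value_Ioo hab.le hc ⟨ha, hb⟩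
  have hs : s ≠ 0 := by rintro rfl; simp at ha
  exact ⟨t, ht.1, ht.2, by simpa [hs] using h⟩

theorem neg_one_pow_succ_sub {m k : ℕ} (h : k ≤ m) :
    (-1 : ℝ) ^ (m + 1 - k) = -(-1) ^ (m - k) := by
  rw [Nat.succ_sub h, pow_succ]; ring

theorem neg_one_pow_sub_mul_self (m k : ℕ) : (-1 : ℝ) ^ (m - k) * (-1) ^ (m - k) = 1 := by
  rw [← mul_pow]; simp

theorem strictMonoOn_extend {m : ℕ} {A B : ℝ} {x : ℕ → ℝ} (hx : StrictMonoOn x (Set.Iio m))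
    (hAB : A < B) (hA : ∀ k < m, A < x k) (hB : ∀ k < m, x k < B) :
    StrictMonoOn (fun k => if k = 0 then A else if k ≤ m then x (k - 1) else B)
      (Set.Iio (m + 2)) := by
  refine strictMonoOn_of_lt_add_one Set.ordConnected_Iio fun k _ _ hk' => ?_
  have hk : k < m + 1 := Nat.succ_lt_succ_iff.1 hk'
  by_cases h0 : k = 0
  · by_cases hm : m = 0
    · simp [h0, hm, hAB]
    · simp only [h0]
      rw [if_pos trivial, if_neg (by omega), if_pos (by omega)]
      exact hA _ (by omega)
  · rw [if_neg h0, if_pos (by omega), if_neg (by omega)]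
    split_ifs with h
    · exact hx (by simp; omega) (by simp; omega) (by omega)
    · exact hB _ (by omega)

/-- A polynomial alternating in sign at the points `x` has a root in each complementary interval. -/
theorem Polynomial.exists_interlacing_roots {p : ℝ[X]} {m : ℕ} {x : ℕ → ℝ}
    (hp : p.natDegree = m + 1) (hl : 0 < p.leadingCoeff) (hx : StrictMonoOn x (Set.Iio m))
    (halt : ∀ k < m, 0 < (-1) ^ (m - k) * p.eval (x k)) :
    ∃ y : ℕ → ℝ, StrictMonoOn y (Set.Iio (m + 1)) ∧ (∀ k < m, y k < x k ∧ x k < y (k + 1)) ∧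
      ∀ k < m + 1, p.eval (y k) = 0 := by
  have hM : ∀ k < m, |x k| ≤ ∑ j ∈ Finset.range m, |x j| := fun k hk =>
    Finset.single_le_sum (f := fun j => |x j|) (fun _ _ => abs_nonneg _) (Finset.mem_range.2 hk)
  set M := ∑ j ∈ Finset.range m, |x j|
  have hM0 : 0 ≤ M := Finset.sum_nonneg fun _ _ => abs_nonneg _
  -- Points `A` and `B` beyond all `x k`, where the leading term decides the sign, extend the
  -- alternation to `m + 2` points, giving `m + 1` sign changes.
  obtain ⟨A, hA, hA'⟩ := exists_lt_eval_ge (p := p) (by omega) hl (-M) 1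
  obtain ⟨B, hB, hB'⟩ := exists_gt_eval_ge (p := p) (by omega) hl M 1
  let z : ℕ → ℝ := fun k => if k = 0 then A else if k ≤ m then x (k - 1) else B
  have hz2 : ∀ k < m + 2, 0 < (-1) ^ (m + 1 - k) * p.eval (z k) := by
    intro k hk
    by_cases h0 : k = 0
    · simp only [z, h0, if_true]; rw [hp] at hA'; simpa using by linarith
    · by_cases hm : k ≤ m
      · simp only [z]
        rw [if_neg h0, if_pos hm]
        have := halt (k - 1) (by omega)
        rwa [show m - (k - 1) = m + 1 - k by omega] at this
      · simp only [z]
        rw [if_neg h0, if_neg hm, show m + 1 - k = 0 by omega]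
        simp; linarith
  have hzm : StrictMonoOn z (Set.Iio (m + 2)) :=
    strictMonoOn_extend hx (by linarith)
      (fun k hk => by linarith [neg_abs_le (x k), hM k hk])
      fun k hk => by linarith [le_abs_self (x k), hM k hk]
  have hz1 : ∀ k < m + 1, z k < z (k + 1) := fun k hk =>
    hzm (by simp; omega) (by simp; omega) (by omega)
  -- The bound on `k` sits inside the existential so that `choose` returns a sequence on all of `ℕ`.
  have hex : ∀ k, ∃ t, k < m + 1 → z k < t ∧ t < z (k + 1) ∧ p.eval t = 0 := by
    intro k
    by_cases hk : k < m + 1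
    · have h1 := hz2 k (by omega)
      have h2 := hz2 (k + 1) (by omega)
      rw [neg_one_pow_succ_sub (by omega)] at h1
      rw [Nat.add_sub_add_right] at h2
      obtain ⟨t, ht⟩ := p.exists_root_mem_Ioo (hz1 k hk) (s := (-1) ^ (m - k)) (by linarith) h2
      exact ⟨t, fun _ => ht⟩
    · exact ⟨0, fun h => absurd h hk⟩
  choose y hy using hex
  refine ⟨y, ?_, fun k hk => ?_, fun k hk => (hy k hk).2.2⟩
  · intro i hi j hj hij
    simp only [Set.mem_Iio] at hi hj
    calc y i < z (i + 1) := (hy i hi).2.1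
      _ ≤ z j := hzm.monotoneOn (by simp; omega) (by simp; omega) (by omega)
      _ < y j := (hy j hj).1
  · have h1 := (hy k (by omega)).2.1
    have h2 := (hy (k + 1) (by omega)).1
    have h3 : z (k + 1) = x k := by
      simp only [z]; rw [if_neg (by omega), if_pos (by omega)]; simp
    rw [h3] at h1 h2
    exact ⟨h1, h2⟩

theorem sortedRoot_eq_of_roots_eq {p : ℝ[X]} {n k : ℕ} {e : ℕ → ℝ}
    (he : MonotoneOn e (Set.Iio n)) (hr : p.roots = (Multiset.range n).map e) (hk : k < n) :
    sortedRoot p k = e k := by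
  have h : p.roots = ((List.range n).map e : List ℝ) := hr
  have hs : ((List.range n).map e).Pairwise (· ≤ ·) := by
    rw [List.pairwise_map]
    refine List.pairwise_lt_range.imp_of_mem fun {a b} ha hb hab => ?_
    exact he (by simpa using ha) (by simpa using hb) hab.le
  rw [sortedRoot, h, Multiset.coe_sort, List.mergeSort_eq_self _ hs]
  simp [hk]

theorem Polynomial.roots_eq_map_range {p : ℝ[X]} {n : ℕ} {y : ℕ → ℝ} (hp : p ≠ 0)
    (hn : p.natDegree ≤ n) (hy : StrictMonoOn y (Set.Iio n)) (h0 : ∀ k < n, p.eval (y k) = 0) :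
    p.roots = (Multiset.range n).map y := by
  symm
  refine Multiset.eq_of_le_of_card_le ?_ ?_
  · refine (Multiset.le_iff_subset ?_).2 ?_
    · refine Multiset.Nodup.map_on ?_ (Multiset.nodup_range n)
      intro a ha b hb hab
      exact hy.injOn (by simpa using ha) (by simpa using hb) hab
    · intro t ht
      obtain ⟨k, hk, rfl⟩ := Multiset.mem_map.1 ht
      exact (mem_roots hp).2 (h0 k (by simpa using hk))
  · simpa using (card_roots' p).trans hn

/-- The `n` distinct roots already use up the degree, which leaves no room for a double root. -/
theorem Polynomial.derivative_eval_ne_zero_of_strictMonoOn {p : ℝ[X]} {n : ℕ} {y : ℕ → ℝ}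
    (hp : p ≠ 0) (hn : p.natDegree ≤ n) (hy : StrictMonoOn y (Set.Iio n))
    (h0 : ∀ k < n, p.eval (y k) = 0) {k : ℕ} (hk : k < n) : (derivative p).eval (y k) ≠ 0 := by
  intro h
  have h1 := (one_lt_rootMultiplicity_iff_isRoot hp).2 ⟨h0 k hk, h⟩
  rw [← count_roots, roots_eq_map_range hp hn hy h0] at h1
  have h2 : ((Multiset.range n).map y).Nodup := by
    refine Multiset.Nodup.map_on ?_ (Multiset.nodup_range n)
    intro a ha b hb hab
    exact hy.injOn (by simpa using ha) (by simpa using hb) hab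
  have := Multiset.nodup_iff_count_le_one.1 h2 (y k)
  omega

/-- Roots of multiplicity at most two, listed in increasing order, exhaust the roots. -/
theorem Polynomial.roots_eq_map_range_of_double {p : ℝ[X]} {n : ℕ} {e : ℕ → ℝ} (hp : p ≠ 0)
    (hn : p.natDegree ≤ n) (he : MonotoneOn e (Set.Iio n))
    (he2 : ∀ k, k + 2 < n → e k < e (k + 2))
    (h0 : ∀ k < n, p.eval (e k) = 0)
    (h1 : ∀ k, k + 1 < n → e k = e (k + 1) → (derivative p).eval (e k) = 0) :
    p.roots = (Multiset.range n).map e := by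
  symm
  refine Multiset.eq_of_le_of_card_le ?_ ?_
  · rw [Multiset.le_iff_count]
    intro t
    rw [Multiset.count_map, count_roots]
    set F : Finset ℕ := (Finset.range n).filter fun k => t = e k with hF
    have hcard : (Multiset.filter (fun k => t = e k) (Multiset.range n)).card = F.card := rfl
    rw [hcard]
    have hmem : ∀ k, k ∈ F ↔ k < n ∧ t = e k := by simp [hF]
    rcases F.eq_empty_or_nonempty with hE | hE
    · simp [hE]
    · set a := F.min' hE
      have ha := (hmem a).1 (F.min'_mem hE)
      -- By `he2` a value is taken at no more than two indices, necessarily consecutive; when it is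
      -- taken twice, `h1` supplies the second order of vanishing.
      have hsub : F ⊆ {a, a + 1} := by
        intro k hk
        have hk' := (hmem k).1 hk
        have hak : a ≤ k := F.min'_le k hk
        by_contra hne
        simp only [Finset.mem_insert, Finset.mem_singleton, not_or] at hne
        have h3 := he2 a (by omega)
        have h4 : e (a + 2) ≤ e k := he (by simp; omega) (by simpa using hk'.1) (by omega)
        linarith [ha.2, hk'.2]
      have hroot : p.IsRoot t := by rw [ha.2]; exact h0 a ha.1
      by_cases hb : a + 1 ∈ F
      · have hb' := (hmem _).1 hb
        have hd : (derivative p).IsRoot t := by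
          rw [ha.2]; exact h1 a hb'.1 (ha.2.symm.trans hb'.2)
        have := (one_lt_rootMultiplicity_iff_isRoot hp).2 ⟨hroot, hd⟩
        have h5 := Finset.card_le_card hsub
        have h6 : ({a, a + 1} : Finset ℕ).card ≤ 2 := Finset.card_le_two
        omega
      · have h5 : F ⊆ {a} := by
          intro k hk
          have := hsub hk
          simp only [Finset.mem_insert, Finset.mem_singleton] at this ⊢
          rcases this with h | h
          · exact h
          · exact absurd (h ▸ hk) hb
        have h6 := Finset.card_le_card h5
        have h7 := (rootMultiplicity_pos hp).2 hroot
        simp only [Finset.card_singleton] at h6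
        omega
  · simpa using (card_roots' p).trans hn

/-! ### The band structure of a Lyapunov-type polynomial. -/

/-- The zeros `μ`, the critical points (with the two outermost band edges adjoined) `κ` and the
band edges `e` of a Lyapunov-type polynomial `D` of degree `m + 1`. -/
structure IsBandStructure (D : ℝ[X]) (m : ℕ) (μ κ e : ℕ → ℝ) : Prop where
  strictMonoOn_zero : StrictMonoOn μ (Set.Iio (m + 1))
  eval_zero : ∀ k < m + 1, D.eval (μ k) = 0
  strictMonoOn_crit : StrictMonoOn κ (Set.Iio (m + 2))
  crit_lt_zero : ∀ k < m + 1, κ k < μ k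
  zero_lt_crit : ∀ k < m + 1, μ k < κ (k + 1)
  one_le : ∀ k < m + 2, 1 ≤ (-1) ^ (m + 1 - k) * D.eval (κ k)
  eval_first : (-1) ^ (m + 1) * D.eval (κ 0) = 1
  eval_last : D.eval (κ (m + 1)) = 1
  derivative_eval_eq_zero_iff : ∀ t, (derivative D).eval t = 0 ↔ ∃ k < m, κ (k + 1) = t
  derivative_derivative_ne : ∀ k < m, (derivative (derivative D)).eval (κ (k + 1)) ≠ 0
  strictMonoOn_eval : ∀ k < m + 1,
    StrictMonoOn (fun t => (-1) ^ (m - k) * D.eval t) (Set.Icc (κ k) (κ (k + 1)))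
  monotoneOn_edge : MonotoneOn e (Set.Iio (2 * m + 2))
  roots_eq : (D ^ 2 - 1).roots = (Multiset.range (2 * m + 2)).map e
  crit_le_edge : ∀ k < m + 1, κ k ≤ e (2 * k)
  edge_lt_zero : ∀ k < m + 1, e (2 * k) < μ k
  zero_lt_edge : ∀ k < m + 1, μ k < e (2 * k + 1)
  edge_le_crit : ∀ k < m + 1, e (2 * k + 1) ≤ κ (k + 1)

theorem Polynomial.exists_eval_eq_mem_Icc (p : ℝ[X]) {a b s c : ℝ} (hab : a ≤ b)
    (ha : s * p.eval a ≤ c) (hb : c ≤ s * p.eval b) : ∃ t ∈ Set.Icc a b, s * p.eval t = c := by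
  have hc : ContinuousOn (fun t => s * p.eval t) (Set.Icc a b) := by fun_prop
  obtain ⟨t, ht, h⟩ := intermediate_value_Icc hab hc ⟨ha, hb⟩
  exact ⟨t, ht, h⟩

/-- Alternation at the `ν k` produces `m + 1` zeros, and Rolle produces `m` critical points between
them, which is all that the degree of `D'` allows. So `D` is monotone between consecutive `κ`, and
its modulus at a critical point is at least that at the `ν k` in the same interval. The values `±1`
are then attained on either side of every zero, and these `2m + 2` points, counted with
multiplicity, exhaust the roots of `D² - 1`. -/
theorem exists_isBandStructure {D : ℝ[X]} {m : ℕ} {ν : ℕ → ℝ} (hD : D.natDegree = m + 1)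
    (hl : 0 < D.leadingCoeff) (hν : StrictMonoOn ν (Set.Iio m))
    (halt : ∀ k < m, 1 ≤ (-1) ^ (m - k) * D.eval (ν k)) :
    ∃ μ κ e : ℕ → ℝ, IsBandStructure D m μ κ e ∧ ∀ k < m, μ k < ν k ∧ ν k < μ (k + 1) := by
  obtain ⟨μ, hμ, hμν, hμ0⟩ := exists_interlacing_roots hD hl hν fun k hk => by linarith [halt k hk]
  have hμc : ∀ k < m, μ k < μ (k + 1) := fun k hk => (hμν k hk).1.trans (hμν k hk).2
  -- critical points
  have hex : ∀ k, ∃ t, k < m → μ k < t ∧ t < μ (k + 1) ∧ (derivative D).eval t = 0 := by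
    intro k
    by_cases hk : k < m
    · obtain ⟨t, ht, h⟩ := exists_deriv_eq_zero (f := fun t => D.eval t) (hμc k hk) (by fun_prop)
        (by simp only [hμ0 k (by omega), hμ0 (k + 1) (by omega)])
      exact ⟨t, fun _ => ⟨ht.1, ht.2, by simpa using h⟩⟩
    · exact ⟨0, fun h => absurd h hk⟩
  choose lam hlam using hex
  have hlm : StrictMonoOn lam (Set.Iio m) := by
    intro i hi j hj hij
    simp only [Set.mem_Iio] at hi hj
    calc lam i < μ (i + 1) := (hlam i hi).2.1
      _ ≤ μ j := hμ.monotoneOn (by simp; omega) (by simp; omega) (by omega)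
      _ < lam j := (hlam j hj).1
  have hdd : (derivative D).natDegree ≤ m := by
    have := natDegree_derivative_le D; omega
  have hc : 0 < (derivative D).coeff m := by
    rw [coeff_derivative, ← hD, coeff_natDegree]
    positivity
  -- The complete factorisation of `D'` provides its sign on every interval between critical points.
  have hfac := eq_C_mul_prod_of_eval hlm hdd fun k hk => (hlam k hk).2.2
  set c := (derivative D).coeff m
  have hfac' : ∀ t, (derivative D).eval t = c * ∏ j ∈ Finset.range m, (t - lam j) := by
    intro t
    rw [hfac, eval_mul, eval_C, eval_prod]
    simp
  -- the outermost edges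
  have hfirst : ∃ A, A < μ 0 ∧ (-1) ^ (m + 1) * D.eval A = 1 := by
    obtain ⟨A, hA, hA'⟩ := exists_lt_eval_ge (p := D) (by omega) hl (μ 0) 1
    rw [hD] at hA'
    -- The sign is reversed because the helper expects a passage upwards, here from at most `-1` at
    -- `A` to `0` at `μ 0`.
    obtain ⟨t, ht, h⟩ := D.exists_eval_eq_mem_Icc (s := -(-1) ^ (m + 1)) (c := -1) hA.le
      (by linarith) (by rw [hμ0 0 (by omega)]; norm_num)
    refine ⟨t, ht.2.lt_of_ne ?_, by linarith⟩
    rintro rfl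
    rw [hμ0 0 (by omega)] at h
    norm_num at h
  have hlast : ∃ B, μ m < B ∧ D.eval B = 1 := by
    obtain ⟨B, hB, hB'⟩ := exists_gt_eval_ge (p := D) (by omega) hl (μ m) 1
    obtain ⟨t, ht, h⟩ := D.exists_eval_eq_mem_Icc (s := 1) (c := 1) hB.le
      (by rw [hμ0 m (by omega)]; norm_num) (by linarith)
    refine ⟨t, ht.1.lt_of_ne ?_, by linarith⟩
    rintro rfl
    rw [hμ0 m (by omega)] at h
    norm_num at h
  obtain ⟨A, hA, hA1⟩ := hfirst
  obtain ⟨B, hB, hB1⟩ := hlast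
  have hμ0m : μ 0 ≤ μ m := hμ.monotoneOn (by simp) (by simp) (by omega)
  set κ : ℕ → ℝ := fun k => if k = 0 then A else if k ≤ m then lam (k - 1) else B with hκdef
  have hκ0 : κ 0 = A := by simp [κ]
  have hκs : ∀ k < m, κ (k + 1) = lam k := by
    intro k hk; simp only [κ]; rw [if_neg (by omega), if_pos (by omega)]; simp
  have hκl : κ (m + 1) = B := by simp [κ]
  have hκ : StrictMonoOn κ (Set.Iio (m + 2)) := by
    refine strictMonoOn_extend hlm (by linarith) (fun k hk => ?_) fun k hk => ?_
    · have h1 : μ 0 ≤ μ k := hμ.monotoneOn (by simp) (by simp; omega) (by omega)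
      linarith [(hlam k hk).1]
    · have h1 : μ (k + 1) ≤ μ m := hμ.monotoneOn (by simp; omega) (by simp) (by omega)
      linarith [(hlam k hk).2.1]
  have hκμ : ∀ k < m + 1, κ k < μ k := by
    rintro (_ | k) hk
    · rwa [hκ0]
    · rw [hκs k (by omega)]; exact (hlam k (by omega)).2.1
  have hμκ : ∀ k < m + 1, μ k < κ (k + 1) := by
    intro k hk
    by_cases hkm : k = m
    · rw [hkm, hκl]; exact hB
    · rw [hκs k (by omega)]; exact (hlam k (by omega)).1
  have hκκ : ∀ k < m + 1, κ k < κ (k + 1) := fun k hk => (hκμ k hk).trans (hμκ k hk)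
  -- monotonicity
  have hmono : ∀ k < m + 1,
      StrictMonoOn (fun t => (-1) ^ (m - k) * D.eval t) (Set.Icc (κ k) (κ (k + 1))) := by
    intro k hk
    refine strictMonoOn_of_deriv_pos (convex_Icc _ _) (by fun_prop) fun t ht => ?_
    rw [interior_Icc] at ht
    have hd : deriv (fun t => (-1) ^ (m - k) * D.eval t) t
        = (-1) ^ (m - k) * (derivative D).eval t := by
      rw [deriv_const_mul _ D.differentiableAt, Polynomial.deriv]
    rw [hd, hfac', mul_left_comm]
    refine mul_pos hc (neg_one_pow_mul_prod_sub_pos (by omega) (fun j hj => ?_) fun j hj hjm => ?_)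
    · rw [← hκs j (by omega)]
      exact lt_of_le_of_lt (hκ.monotoneOn (by simp; omega) (by simp; omega) (by omega)) ht.1
    · rw [← hκs j (by omega)]
      exact lt_of_lt_of_le ht.2 (hκ.monotoneOn (by simp; omega) (by simp; omega) (by omega))
  have hone : ∀ k < m + 2, 1 ≤ (-1) ^ (m + 1 - k) * D.eval (κ k) := by
    rintro (_ | k) hk
    · rw [hκ0]; simpa using hA1.ge
    · rw [Nat.add_sub_add_right]
      by_cases hkm : k = m
      · rw [hkm, hκl]; simpa using hB1.ge
      · have hk' : k < m := by omega
        refine (halt k hk').trans ?_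
        -- The point `ν k` may lie on either side of the critical point; from both sides the signed
        -- value of `D` grows towards it.
        rcases le_total (ν k) (κ (k + 1)) with h | h
        · exact (hmono k (by omega)).monotoneOn
            ⟨(hκμ k (by omega)).le.trans (hμν k hk').1.le, h⟩
            ⟨(hκκ k (by omega)).le, le_rfl⟩ h
        · have := (hmono (k + 1) (by omega)).monotoneOn ⟨le_rfl, (hκκ (k + 1) (by omega)).le⟩
            ⟨h, (hμν k hk').2.le.trans (hμκ (k + 1) (by omega)).le⟩ h
          have hs : (-1 : ℝ) ^ (m - k) = -(-1) ^ (m - (k + 1)) := by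
            rw [← neg_one_pow_succ_sub (by omega), Nat.add_sub_add_right]
          rw [hs]; linarith
  -- edges
  have hexl : ∀ k, ∃ t, k < m + 1 → t ∈ Set.Icc (κ k) (μ k) ∧ (-1) ^ (m - k) * D.eval t = -1 := by
    intro k
    by_cases hk : k < m + 1
    · have h1 := hone k (by omega)
      rw [neg_one_pow_succ_sub (by omega)] at h1
      obtain ⟨t, ht⟩ := D.exists_eval_eq_mem_Icc (s := (-1) ^ (m - k)) (c := -1) (hκμ k hk).le
        (by linarith) (by rw [hμ0 k hk]; norm_num)
      exact ⟨t, fun _ => ht⟩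
    · exact ⟨0, fun h => absurd h hk⟩
  have hexr : ∀ k, ∃ t, k < m + 1 → t ∈ Set.Icc (μ k) (κ (k + 1)) ∧
      (-1) ^ (m - k) * D.eval t = 1 := by
    intro k
    by_cases hk : k < m + 1
    · have h1 := hone (k + 1) (by omega)
      rw [Nat.add_sub_add_right] at h1
      obtain ⟨t, ht⟩ := D.exists_eval_eq_mem_Icc (s := (-1) ^ (m - k)) (c := 1) (hμκ k hk).le
        (by rw [hμ0 k hk]; norm_num) h1
      exact ⟨t, fun _ => ht⟩
    · exact ⟨0, fun h => absurd h hk⟩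
  choose el hel using hexl
  choose er her using hexr
  have hellt : ∀ k < m + 1, el k < μ k := fun k hk => (hel k hk).1.2.lt_of_ne <| by
    intro h
    have := (hel k hk).2
    rw [h, hμ0 k hk] at this
    norm_num at this
  have hltr : ∀ k < m + 1, μ k < er k := fun k hk => (her k hk).1.1.lt_of_ne <| by
    intro h
    have := (her k hk).2
    rw [← h, hμ0 k hk] at this
    norm_num at this
  -- Even indices are left ends of bands, odd indices right ends.
  set e : ℕ → ℝ := fun i => if i % 2 = 0 then el (i / 2) else er (i / 2) with he
  have he0 : ∀ k, e (2 * k) = el k := fun k => by simp [e]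
  have he1 : ∀ k, e (2 * k + 1) = er k := fun k => by
    simp only [e]; rw [if_neg (by omega)]; congr 1; omega
  have hem : MonotoneOn e (Set.Iio (2 * m + 2)) := by
    refine monotoneOn_of_le_add_one Set.ordConnected_Iio fun i _ _ hi' => ?_
    have hi : i + 1 < 2 * m + 2 := hi'
    rcases Nat.even_or_odd' i with ⟨k, rfl | rfl⟩
    · rw [he0, he1]; exact ((hellt k (by omega)).trans (hltr k (by omega))).le
    · rw [he1, show 2 * k + 1 + 1 = 2 * (k + 1) by ring, he0]
      exact (her k (by omega)).1.2.trans (hel (k + 1) (by omega)).1.1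
  -- Two consecutive steps always cross a band, and bands are nondegenerate since each has a zero of
  -- `D` strictly inside.
  have he2 : ∀ i, i + 2 < 2 * m + 2 → e i < e (i + 2) := by
    intro i hi
    rcases Nat.even_or_odd' i with ⟨k, rfl | rfl⟩
    · calc e (2 * k) < e (2 * k + 1) := by
            rw [he0, he1]; exact (hellt k (by omega)).trans (hltr k (by omega))
        _ ≤ _ := hem (by simp; omega) (by simp; omega) (by omega)
    · calc e (2 * k + 1) ≤ e (2 * (k + 1)) := hem (by simp; omega) (by simp; omega) (by omega)
        _ < e (2 * (k + 1) + 1) := by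
            rw [he0, he1]; exact (hellt _ (by omega)).trans (hltr _ (by omega))
        _ = _ := by ring_nf
  have hsq : ∀ (s : ℝ) (k : ℕ) (t : ℝ), s * s = 1 → (-1) ^ (m - k) * D.eval t = s →
      (D ^ 2 - 1).eval t = 0 := by
    intro s k t hs h
    have h2 := neg_one_pow_sub_mul_self m k
    have h3 : D.eval t ^ 2 = 1 := by
      calc D.eval t ^ 2 = ((-1) ^ (m - k) * (-1) ^ (m - k)) * D.eval t ^ 2 := by rw [h2, one_mul]
        _ = ((-1) ^ (m - k) * D.eval t) * ((-1) ^ (m - k) * D.eval t) := by ring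
        _ = 1 := by rw [h, hs]
    simp [h3]
  have hDne : D ^ 2 - 1 ≠ 0 := by
    intro h
    have := congrArg (fun p => eval (μ 0) p) h
    simp [hμ0 0 (by omega)] at this
  have hroots : (D ^ 2 - 1).roots = (Multiset.range (2 * m + 2)).map e := by
    refine roots_eq_map_range_of_double hDne ?_ hem he2 ?_ ?_
    · refine (natDegree_sub_le _ _).trans ?_
      rw [natDegree_pow, hD, natDegree_one]
      omega
    · intro i hi
      rcases Nat.even_or_odd' i with ⟨k, rfl | rfl⟩
      · rw [he0]; exact hsq (-1) k _ (by norm_num) (hel k (by omega)).2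
      · rw [he1]; exact hsq 1 k _ (by norm_num) (her k (by omega)).2
    · intro i hi hii
      rcases Nat.even_or_odd' i with ⟨k, rfl | rfl⟩
      · rw [he0, he1] at hii
        exact absurd hii ((hellt k (by omega)).trans (hltr k (by omega))).ne
      -- A closed gap: both ends are squeezed onto the critical point, so `(D² - 1)' = 2 D D'`
      -- vanishes there too.
      · rw [show 2 * k + 1 + 1 = 2 * (k + 1) by ring, he0, he1] at hii
        have h1 := (her k (by omega)).1.2
        have h2 := (hel (k + 1) (by omega)).1.1
        have h3 : e (2 * k + 1) = lam k := by
          rw [he1, ← hκs k (by omega)]; exact le_antisymm h1 (hii ▸ h2)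
        rw [h3]
        simp [derivative_pow, (hlam k (by omega)).2.2]
  refine ⟨μ, κ, e, ⟨hμ, hμ0, hκ, hκμ, hμκ, hone, by rwa [hκ0], by rwa [hκl], fun t => ?_,
    fun k hk => ?_, hmono, hem, hroots, ?_, ?_, ?_, ?_⟩, hμν⟩
  · rw [hfac', mul_eq_zero, Finset.prod_eq_zero_iff]
    constructor
    · rintro (h | ⟨j, hj, h⟩)
      · exact absurd h hc.ne'
      · rw [Finset.mem_range] at hj
        exact ⟨j, hj, by rw [hκs j hj]; linarith⟩
    · rintro ⟨j, hj, rfl⟩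
      exact Or.inr ⟨j, Finset.mem_range.2 hj, by rw [hκs j hj, sub_self]⟩
  · rw [hκs k hk]
    exact derivative_eval_ne_zero_of_strictMonoOn (fun h => hc.ne' (by simp [c, h])) hdd hlm
      (fun k hk => (hlam k hk).2.2) hk
  · intro k hk; rw [he0]; exact (hel k hk).1.1
  · intro k hk; rw [he0]; exact hellt k hk
  · intro k hk; rw [he1]; exact hltr k hk
  · intro k hk; rw [he1]; exact (her k hk).1.2

namespace IsBandStructure

variable {D : ℝ[X]} {m : ℕ} {μ κ e : ℕ → ℝ}

theorem sortedRoot_eq (h : IsBandStructure D m μ κ e) {i : ℕ} (hi : i < 2 * m + 2) :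
    sortedRoot (D ^ 2 - 1) i = e i :=
  sortedRoot_eq_of_roots_eq h.monotoneOn_edge h.roots_eq hi

theorem crit_lt_crit (h : IsBandStructure D m μ κ e) {k : ℕ} (hk : k < m + 1) :
    κ k < κ (k + 1) := (h.crit_lt_zero k hk).trans (h.zero_lt_crit k hk)

/-- In the closed interval between two consecutive zeros, `|D|` has a strict maximum at the
critical point. -/
theorem eval_lt (h : IsBandStructure D m μ κ e) {k : ℕ} (hk : k < m) {t : ℝ}
    (h1 : κ k ≤ t) (h2 : t ≤ κ (k + 2)) (hne : t ≠ κ (k + 1)) :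
    (-1) ^ (m - k) * D.eval t < (-1) ^ (m - k) * D.eval (κ (k + 1)) := by
  rcases hne.lt_or_gt with hlt | hlt
  · exact h.strictMonoOn_eval k (by omega) ⟨h1, hlt.le⟩ ⟨(h.crit_lt_crit (by omega)).le, le_rfl⟩ hlt
  · have := h.strictMonoOn_eval (k + 1) (by omega) ⟨le_rfl, (h.crit_lt_crit (by omega)).le⟩
      ⟨hlt.le, h2⟩ hlt
    simp only at this
    have hs : (-1 : ℝ) ^ (m - k) = -(-1) ^ (m - (k + 1)) := by
      rw [← neg_one_pow_succ_sub (by omega), Nat.add_sub_add_right]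
    rw [hs]; linarith

theorem eq_of_derivative_eval_eq_zero (h : IsBandStructure D m μ κ e) {k : ℕ} (hk : k < m) {t : ℝ}
    (h1 : μ k < t) (h2 : t < μ (k + 1)) (h0 : (derivative D).eval t = 0) : t = κ (k + 1) := by
  obtain ⟨j, hj, rfl⟩ := (h.derivative_eval_eq_zero_iff t).1 h0
  have h3 := h.crit_lt_zero (j + 1) (by omega)
  have h4 := h.zero_lt_crit j (by omega)
  have h5 : k < j + 1 :=
    (h.strictMonoOn_zero.lt_iff_lt (by simp; omega) (by simp; omega)).1 (h1.trans h3)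
  have h6 : j < k + 1 :=
    (h.strictMonoOn_zero.lt_iff_lt (by simp; omega) (by simp; omega)).1 (h4.trans h2)
  rw [show j = k by omega]

/-- The opposite sign would give a local minimum, against the strict maximum of `eval_lt`. This
supplies positivity of `heightQuotient` in the case `ν_n = λ_n`. -/
theorem derivative_derivative_neg (h : IsBandStructure D m μ κ e) {k : ℕ} (hk : k < m) :
    (-1) ^ (m - k) * (derivative (derivative D)).eval (κ (k + 1)) < 0 := by
  have hne : (-1) ^ (m - k) * (derivative (derivative D)).eval (κ (k + 1)) ≠ 0 :=
    mul_ne_zero (by simp) (h.derivative_derivative_ne k hk)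
  by_contra hpos
  have hpos' := (not_lt.1 hpos).lt_of_ne hne.symm
  have hd : ∀ t, HasDerivAt (fun t => (-1) ^ (m - k) * D.eval t)
      ((-1) ^ (m - k) * (derivative D).eval t) t := fun t => (D.hasDerivAt t).const_mul _
  have hd1 : deriv (fun t => (-1) ^ (m - k) * D.eval t) =
      fun t => (-1) ^ (m - k) * (derivative D).eval t := funext fun t => (hd t).deriv
  have hmin : IsLocalMin (fun t => (-1) ^ (m - k) * D.eval t) (κ (k + 1)) := by
    refine isLocalMin_of_deriv_deriv_pos ?_ ?_ (hd _).continuousAt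
    · rw [hd1, ((derivative D).hasDerivAt _ |>.const_mul _).deriv]
      exact hpos'
    · rw [hd1]
      simp only [(h.derivative_eval_eq_zero_iff _).2 ⟨k, hk, rfl⟩, mul_zero]
  have h1 : ∀ᶠ t in nhds (κ (k + 1)), κ k < t ∧ t < κ (k + 2) :=
    Ioo_mem_nhds (h.crit_lt_crit (by omega)) (h.crit_lt_crit (by omega))
  obtain ⟨ε, hε, hball⟩ := Metric.eventually_nhds_iff.1 (hmin.and h1)
  have h2 := hball (y := κ (k + 1) + ε / 2) (by simp [abs_of_pos hε, hε])
  have h3 := h.eval_lt hk h2.2.1.le h2.2.2.le (by linarith)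
  linarith [h2.1]

end IsBandStructure

/-! ### The solutions of the recurrence: coefficients, Wronskian, oscillation. -/

noncomputable section

theorem ZMod.prod_range_natCast_succ {M : Type*} [CommMonoid M] {m : ℕ} (f : ZMod (m + 1) → M) :
    ∏ k ∈ Finset.range (m + 1), f ((k + 1 : ℕ) : ZMod (m + 1)) = ∏ z, f z := by
  have h : ∏ k ∈ Finset.range (m + 1), f ((k + 1 : ℕ) : ZMod (m + 1)) =
      ∏ z : ZMod (m + 1), f (z + 1) := by
    rw [Finset.prod_range]
    refine Finset.prod_congr rfl fun i _ => ?_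
    rw [Nat.cast_succ]
    congr 2
    exact Fin.cast_val_eq_self i
  rw [h]
  exact Fintype.prod_equiv (Equiv.addRight 1) _ _ fun _ => rfl

theorem ZMod.sum_range_natCast_succ {M : Type*} [AddCommMonoid M] {m : ℕ} (f : ZMod (m + 1) → M) :
    ∑ k ∈ Finset.range (m + 1), f ((k + 1 : ℕ) : ZMod (m + 1)) = ∑ z, f z :=
  ZMod.prod_range_natCast_succ (M := Multiplicative M) f

theorem Polynomial.coeff_X_sub_C_mul_succ {R : Type*} [CommRing R] (p : R[X]) (b : R) (n : ℕ) :
    ((X - C b) * p).coeff (n + 1) = p.coeff n - b * p.coeff (n + 1) := by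
  rw [sub_mul, coeff_sub, coeff_X_mul, coeff_C_mul]

namespace JacobiData

section

variable {N : ℕ} [NeZero N] (q : JacobiData N)

theorem a_pos (n : ZMod N) : 0 < q.a n := Real.exp_pos _

theorem a_ne (n : ZMod N) : q.a n ≠ 0 := (q.a_pos n).ne'

/-- The monic multiple of `φ_n`. -/
def monicPhi : ℕ → ℝ[X]
  | 0 => 0
  | 1 => 1
  | n + 2 => (X - C (q.b (n + 1 : ℕ))) * monicPhi (n + 1) - C (q.a n ^ 2) * monicPhi n

/-- The product `a_1 ⋯ a_n`. -/
def prodA (n : ℕ) : ℝ := ∏ k ∈ Finset.range n, q.a (k + 1 : ℕ)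

theorem prodA_succ (n : ℕ) : q.prodA (n + 1) = q.prodA n * q.a (n + 1 : ℕ) :=
  Finset.prod_range_succ _ _

theorem prodA_pos (n : ℕ) : 0 < q.prodA n := Finset.prod_pos fun _ _ => q.a_pos _

theorem C_a_mul_solution (y₀ y₁ : ℝ[X]) (n : ℕ) :
    C (q.a (n + 1 : ℕ)) * q.solution y₀ y₁ (n + 2) =
      (X - C (q.b (n + 1 : ℕ))) * q.solution y₀ y₁ (n + 1) - C (q.a n) * q.solution y₀ y₁ n := by
  rw [solution, ← mul_assoc, ← C_mul, mul_inv_cancel₀ (q.a_ne _), C_1, one_mul]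

/-- Clearing the denominators leaves a recurrence with coefficients `b` and `a²`. Over a full period
the factor is `1` because `∑ x = 0`, so `φ_{N+1}` is itself monic. -/
theorem C_prodA_mul_phi (n : ℕ) : C (q.prodA n) * q.phi (n + 1) = q.monicPhi (n + 1) := by
  induction n using Nat.twoStepInduction with
  | zero => simp [prodA, phi, solution, monicPhi]
  | one =>
    simp [prodA, phi, monicPhi, solution, ← mul_assoc, ← C_mul, q.a_ne]
  | more n ih1 ih2 =>
    rw [monicPhi, ← ih1, ← ih2]
    have := q.C_a_mul_solution 0 1 (n + 1)
    simp only [phi]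
    rw [prodA_succ q (n + 1), C_mul, mul_assoc, show n + 1 + 1 = n + 2 from rfl] at *
    rw [this, prodA_succ q n, C_mul, C_pow]
    ring

/-- Cross-multiplying the two recurrences cancels the terms `(λ - b) φ ϑ`, so `a_n` times the
Wronskian does not depend on `n`. -/
theorem wronskian (n : ℕ) :
    C (q.a n) * (q.phi (n + 1) * q.theta n - q.phi n * q.theta (n + 1)) = C (q.a 0) := by
  induction n with
  | zero => simp [phi, theta, solution]
  | succ n ih =>
    rw [← ih]
    have h1 := q.C_a_mul_solution 0 1 n
    have h2 := q.C_a_mul_solution 1 0 n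
    simp only [phi, theta]
    calc _ = (C (q.a (n + 1 : ℕ)) * q.solution 0 1 (n + 2)) * q.solution 1 0 (n + 1)
          - q.solution 0 1 (n + 1) * (C (q.a (n + 1 : ℕ)) * q.solution 1 0 (n + 2)) := by
            ring
      _ = _ := by rw [h1, h2]; ring

theorem coeff_monicPhi_of_lt (n : ℕ) : ∀ k, n < k → (q.monicPhi (n + 1)).coeff k = 0 := by
  induction n using Nat.twoStepInduction with
  | zero => intro k hk; simp [monicPhi, coeff_one, hk.ne']
  | one =>
    intro k hk
    obtain ⟨k, rfl⟩ := Nat.exists_eq_succ_of_ne_zero (by omega : k ≠ 0)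
    simp [monicPhi, coeff_X]
    omega
  | more n ih1 ih2 =>
    intro k hk
    obtain ⟨k, rfl⟩ := Nat.exists_eq_succ_of_ne_zero (by omega : k ≠ 0)
    rw [monicPhi, coeff_sub, Nat.succ_eq_add_one, coeff_X_sub_C_mul_succ, coeff_C_mul,
      ih2 k (by omega), ih2 (k + 1) (by omega), ih1 (k + 1) (by omega)]
    simp

theorem coeff_monicPhi_self (n : ℕ) : (q.monicPhi (n + 1)).coeff n = 1 := by
  induction n with
  | zero => simp [monicPhi]
  | succ n ih =>
    rw [monicPhi, coeff_sub, coeff_X_sub_C_mul_succ, coeff_C_mul, ih,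
      q.coeff_monicPhi_of_lt n (n + 1) (by omega)]
    cases n with
    | zero => simp [monicPhi]
    | succ n => rw [q.coeff_monicPhi_of_lt n _ (by omega)]; simp

theorem natDegree_monicPhi (n : ℕ) : (q.monicPhi (n + 1)).natDegree = n := by
  refine le_antisymm (natDegree_le_iff_coeff_eq_zero.2 (q.coeff_monicPhi_of_lt n)) ?_
  exact le_natDegree_of_ne_zero (by rw [coeff_monicPhi_self]; exact one_ne_zero)

theorem monic_monicPhi (n : ℕ) : (q.monicPhi (n + 1)).Monic := by
  rw [Monic, leadingCoeff, natDegree_monicPhi, coeff_monicPhi_self]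

theorem coeff_monicPhi_pred (n : ℕ) :
    (q.monicPhi (n + 2)).coeff n = -∑ k ∈ Finset.range (n + 1), q.b (k + 1 : ℕ) := by
  induction n with
  | zero => simp [monicPhi]
  | succ n ih =>
    rw [monicPhi, coeff_sub, coeff_X_sub_C_mul_succ, coeff_C_mul, ih, coeff_monicPhi_self,
      q.coeff_monicPhi_of_lt n _ (by omega), Finset.sum_range_succ _ (n + 1)]
    ring

/-- `monicPhi (n + 3)` is the characteristic polynomial of the truncated Jacobi matrix of size `n +
2`; this is its sum of principal two-by-two minors. -/
theorem coeff_monicPhi_pred_pred (n : ℕ) :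
    (q.monicPhi (n + 3)).coeff n =
      ((∑ k ∈ Finset.range (n + 2), q.b (k + 1 : ℕ)) ^ 2
        - ∑ k ∈ Finset.range (n + 2), q.b (k + 1 : ℕ) ^ 2) / 2
      - ∑ k ∈ Finset.range (n + 1), q.a (k + 1 : ℕ) ^ 2 := by
  induction n with
  | zero =>
    simp only [monicPhi, mul_one, mul_zero, sub_zero, coeff_sub, coeff_C_zero, mul_coeff_zero,
      coeff_X_zero, Finset.sum_range_succ, Finset.sum_range_zero]
    ring
  | succ n ih =>
    rw [monicPhi, coeff_sub, coeff_X_sub_C_mul_succ, coeff_C_mul, ih, coeff_monicPhi_pred,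
      coeff_monicPhi_self, Finset.sum_range_succ _ (n + 2), Finset.sum_range_succ _ (n + 2),
      Finset.sum_range_succ _ (n + 1), Finset.sum_range_succ _ (n + 1),
      Finset.sum_range_succ _ (n + 1)]
    ring

theorem coeff_theta_of_le (n : ℕ) : ∀ k, n ≤ k → (q.theta (n + 1)).coeff k = 0 := by
  induction n using Nat.twoStepInduction with
  | zero => intro k _; simp [theta, solution]
  | one =>
    intro k hk
    obtain ⟨k, rfl⟩ := Nat.exists_eq_succ_of_ne_zero (by omega : k ≠ 0)
    simp [theta, solution]
  | more n ih1 ih2 =>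
    intro k hk
    obtain ⟨k, rfl⟩ := Nat.exists_eq_succ_of_ne_zero (by omega : k ≠ 0)
    simp only [theta] at *
    rw [solution, coeff_C_mul, coeff_sub, Nat.succ_eq_add_one, coeff_X_sub_C_mul_succ, coeff_C_mul,
      ih2 k (by omega), ih2 (k + 1) (by omega), ih1 (k + 1) (by omega)]
    simp

/-- Over a full period this accounts for the corner entry `a_N = a_0` of the periodic matrix, which
the truncated one misses. -/
theorem coeff_theta (n : ℕ) :
    q.prodA (n + 1) * (q.theta (n + 2)).coeff n = -q.a 0 := by
  induction n with
  | zero =>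
    simp [theta, solution, prodA, q.a_ne]
  | succ n ih =>
    have h1 := q.coeff_theta_of_le (n + 1) (n + 1) le_rfl
    have h2 := q.coeff_theta_of_le n (n + 1) (by omega)
    simp only [theta] at *
    rw [solution, coeff_C_mul, coeff_sub, coeff_X_sub_C_mul_succ, coeff_C_mul, h1, h2, ← ih,
      prodA_succ q (n + 1)]
    have := q.a_ne (n + 1 + 1 : ℕ)
    field_simp
    ring

/-- Sturm oscillation. At a zero of one solution the recurrence makes the next a negative multiple
of the preceding one, whose sign follows from interlacing. The sign clause is what lets the
induction continue. -/
theorem exists_roots_monicPhi (n : ℕ) : ∃ r : ℕ → ℝ, StrictMonoOn r (Set.Iio n) ∧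
    (∀ k < n, (q.monicPhi (n + 1)).eval (r k) = 0) ∧
    ∀ k < n, 0 < (-1) ^ (n - k) * (q.monicPhi (n + 2)).eval (r k) := by
  induction n with
  | zero => exact ⟨fun _ => 0, by simp [StrictMonoOn], by simp, by simp⟩
  | succ n ih =>
    obtain ⟨r, hr, hr0, hrs⟩ := ih
    obtain ⟨y, hy, hyr, hy0⟩ := exists_interlacing_roots (q.natDegree_monicPhi (n + 1))
      (by rw [q.monic_monicPhi]; exact one_pos) hr hrs
    refine ⟨y, hy, hy0, fun k hk => ?_⟩
    have hfac := eq_C_mul_prod_of_eval hr (q.natDegree_monicPhi n).le hr0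
    rw [coeff_monicPhi_self, C_1, one_mul] at hfac
    have hsign : 0 < (-1 : ℝ) ^ (n - k) * ∏ j ∈ Finset.range n, (y k - r j) := by
      refine neg_one_pow_mul_prod_sub_pos (by omega) (fun j hj => ?_) fun j hj hjn => ?_
      · exact (hyr j (by omega)).2.trans_le
          (hy.monotoneOn (by simp; omega) (by simp; omega) (by omega))
      · exact lt_of_le_of_lt (hy.monotoneOn (by simp; omega) (by simp; omega) (by omega))
          (hyr j hjn).1
    have hev : (q.monicPhi (n + 1)).eval (y k) = ∏ j ∈ Finset.range n, (y k - r j) := by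
      rw [hfac, eval_prod]; simp
    have : (q.monicPhi (n + 1 + 2)).eval (y k) =
        -(q.a (n + 1 : ℕ) ^ 2 * (q.monicPhi (n + 1)).eval (y k)) := by
      rw [monicPhi, eval_sub, eval_mul, hy0 k hk]; simp
    rw [this, neg_one_pow_succ_sub (by omega), hev]
    have h2 := mul_pos (pow_pos (q.a_pos (n + 1 : ℕ)) 2) hsign
    linarith

end

/-! ### One full period: the Lyapunov function, and why the spectral data are well defined. -/

theorem gapSign_eq {m : ℕ} (n : Fin (m + 1 - 1)) : gapSign n = (-1) ^ (m - n.val) := by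
  rw [gapSign, Nat.add_sub_add_right]

theorem gapSign_mul_self {m : ℕ} (n : Fin (m + 1 - 1)) : gapSign n * gapSign n = 1 := by
  rw [gapSign_eq, neg_one_pow_sub_mul_self]

section

variable {m : ℕ} [NeZero (m + 1)] (q : JacobiData (m + 1))

theorem sum_x_eq_zero :
    ∑ z, (q.fst : EuclideanSpace ℝ (ZMod (m + 1))) z = 0 := q.fst.2

theorem sum_b_eq_zero : ∑ z, q.b z = 0 := q.snd.2

theorem prodA_period : q.prodA (m + 1) = 1 := by
  rw [prodA, ZMod.prod_range_natCast_succ]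
  simp only [a]
  rw [← Real.exp_sum, sum_x_eq_zero, Real.exp_zero]

theorem phi_period : q.phi (m + 2) = q.monicPhi (m + 2) := by
  have := q.C_prodA_mul_phi (m + 1)
  rwa [prodA_period, C_1, one_mul] at this

theorem a_period : q.a (m + 1 : ℕ) = q.a 0 := by rw [ZMod.natCast_self]

theorem coeff_lyapunov (k : ℕ) : q.lyapunov.coeff k =
    1 / 2 * ((q.monicPhi (m + 2)).coeff k + (q.theta (m + 1)).coeff k) := by
  rw [lyapunov, coeff_C_mul, coeff_add, phi_period]

theorem coeff_lyapunov_of_lt (k : ℕ) (hk : m + 1 < k) : q.lyapunov.coeff k = 0 := by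
  rw [coeff_lyapunov, q.coeff_monicPhi_of_lt _ _ hk, q.coeff_theta_of_le _ _ (by omega)]
  simp

theorem coeff_lyapunov_top : q.lyapunov.coeff (m + 1) = 1 / 2 := by
  rw [coeff_lyapunov, coeff_monicPhi_self, q.coeff_theta_of_le _ _ (by omega)]
  simp

theorem coeff_phi_pred : (q.phi (m + 2)).coeff m = 0 := by
  rw [phi_period, coeff_monicPhi_pred,
    ZMod.sum_range_natCast_succ, sum_b_eq_zero, neg_zero]

theorem coeff_lyapunov_pred : q.lyapunov.coeff m = 0 := by
  rw [coeff_lyapunov, ← phi_period, coeff_phi_pred, q.coeff_theta_of_le _ _ le_rfl]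
  simp

theorem natDegree_lyapunov : q.lyapunov.natDegree = m + 1 := by
  refine le_antisymm (natDegree_le_iff_coeff_eq_zero.2 q.coeff_lyapunov_of_lt) ?_
  exact le_natDegree_of_ne_zero (by rw [coeff_lyapunov_top]; norm_num)

theorem leadingCoeff_lyapunov : q.lyapunov.leadingCoeff = 1 / 2 := by
  rw [leadingCoeff, natDegree_lyapunov, coeff_lyapunov_top]

theorem exists_dirichlet : ∃ ν : ℕ → ℝ, StrictMonoOn ν (Set.Iio m) ∧
    (∀ n, q.dirichletEigenvalue n = ν n.val) ∧ (∀ k < m, (q.phi (m + 1)).eval (ν k) = 0) ∧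
    (∀ k < m, 0 < (-1) ^ (m - k) * (q.phi (m + 2)).eval (ν k)) ∧
    ∀ t, (q.phi (m + 1)).eval t = 0 → ∃ k < m, ν k = t := by
  obtain ⟨ν, hν, hν0, hνs⟩ := q.exists_roots_monicPhi m
  have hev : ∀ t, q.prodA m * (q.phi (m + 1)).eval t = (q.monicPhi (m + 1)).eval t := fun t => by
    rw [← C_prodA_mul_phi, eval_mul, eval_C]
  have h0 : ∀ t, (q.phi (m + 1)).eval t = 0 ↔ (q.monicPhi (m + 1)).eval t = 0 := fun t => by
    rw [← hev]; simp [(q.prodA_pos m).ne']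
  have hr1 : (q.monicPhi (m + 1)).roots = (Multiset.range m).map ν :=
    roots_eq_map_range (q.monic_monicPhi m).ne_zero (q.natDegree_monicPhi m).le hν hν0
  have hr : (q.phi (m + 1)).roots = (Multiset.range m).map ν := by
    rw [← hr1, ← C_prodA_mul_phi, roots_C_mul _ (q.prodA_pos m).ne']
  refine ⟨ν, hν, fun n => sortedRoot_eq_of_roots_eq hν.monotoneOn hr n.2,
    fun k hk => (h0 _).2 (hν0 k hk), fun k hk => by rw [phi_period]; exact hνs k hk,
    fun t ht => ?_⟩
  have := (mem_roots (q.monic_monicPhi m).ne_zero).2 ((h0 t).1 ht)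
  rw [hr1, Multiset.mem_map] at this
  simpa using this

theorem eval_theta_of_eval_phi_eq_zero {t : ℝ} (ht : (q.phi (m + 1)).eval t = 0) :
    (q.phi (m + 2)).eval t * (q.theta (m + 1)).eval t = 1 := by
  have h := congrArg (eval t) (q.wronskian (m + 1))
  rw [a_period, eval_mul, eval_C, eval_sub, eval_mul, eval_mul, ht, zero_mul,
    sub_zero] at h
  exact mul_left_cancel₀ (q.a_ne 0) (by rw [mul_one]; exact h)

theorem gapSign_mul_phi_pos (n : Fin (m + 1 - 1)) :
    0 < gapSign n * (q.phi (m + 2)).eval (q.dirichletEigenvalue n) := by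
  obtain ⟨ν, -, h, -, hs, -⟩ := q.exists_dirichlet
  rw [gapSign_eq, h]
  exact hs _ n.2

theorem eval_phi_dirichletEigenvalue (n : Fin (m + 1 - 1)) :
    (q.phi (m + 1)).eval (q.dirichletEigenvalue n) = 0 := by
  obtain ⟨ν, -, h, h0, -⟩ := q.exists_dirichlet
  rw [h]; exact h0 _ n.2

/-- At the Dirichlet eigenvalues, `(-1)^{N-n} Δ = cosh ψ_{1,n}`. -/
theorem cosh_normingConstant (n : Fin (m + 1 - 1)) :
    Real.cosh (q.normingConstant n) = gapSign n * q.lyapunov.eval (q.dirichletEigenvalue n) := by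
  have hpos := q.gapSign_mul_phi_pos n
  have hw := q.eval_theta_of_eval_phi_eq_zero (q.eval_phi_dirichletEigenvalue n)
  have hs := gapSign_mul_self n
  rw [normingConstant, Real.cosh_log hpos, lyapunov, eval_mul, eval_C, eval_add]
  have : (gapSign n * (q.phi (m + 2)).eval (q.dirichletEigenvalue n))⁻¹ =
      gapSign n * (q.theta (m + 1)).eval (q.dirichletEigenvalue n) := by
    refine inv_eq_of_mul_eq_one_right ?_
    rw [mul_mul_mul_comm, hs, hw, one_mul]
  rw [this]
  ring

/-- `cosh_normingConstant` provides the alternation that `exists_isBandStructure` needs. The closed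
gap with zero-based index `n` is `[e (2n + 1), e (2n + 2)]`. It lies strictly between two zeros of
`Δ`, where `κ (n + 1)` is the only critical point. -/
theorem exists_bandStructure : ∃ μ κ e : ℕ → ℝ, IsBandStructure q.lyapunov m μ κ e ∧
    ∀ n : Fin (m + 1 - 1),
      (∀ t, q.IsGapCriticalPoint n t ↔ t = κ (n.val + 1)) ∧ q.criticalPoint n = κ (n.val + 1) ∧
      μ n.val < q.dirichletEigenvalue n ∧ q.dirichletEigenvalue n < μ (n.val + 1) := by
  obtain ⟨ν, hν, hνn, -⟩ := q.exists_dirichlet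
  obtain ⟨μ, κ, e, hB, hμν⟩ := exists_isBandStructure q.natDegree_lyapunov
    (by rw [leadingCoeff_lyapunov]; norm_num) hν fun k hk => by
      have := q.cosh_normingConstant ⟨k, hk⟩
      rw [gapSign_eq, hνn] at this
      rw [← this]
      exact Real.one_le_cosh _
  refine ⟨μ, κ, e, hB, fun n => ?_⟩
  have hn : n.val < m := n.2
  have hiff : ∀ t, q.IsGapCriticalPoint n t ↔ t = κ (n.val + 1) := by
    intro t
    have hl : q.gapLeft (n.val + 1) = e (2 * n.val + 1) := by
      rw [gapLeft, bandEdge, show 2 * (n.val + 1) - 1 = 2 * n.val + 1 by omega,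
        hB.sortedRoot_eq (by omega)]
    have hr : q.gapRight (n.val + 1) = e (2 * (n.val + 1)) := by
      rw [gapRight, bandEdge, hB.sortedRoot_eq (by omega)]
    rw [IsGapCriticalPoint, hl, hr]
    constructor
    · rintro ⟨⟨h1, h2⟩, h3, -⟩
      exact hB.eq_of_derivative_eval_eq_zero hn ((hB.zero_lt_edge _ (by omega)).trans_le h1)
        (h2.trans_lt (hB.edge_lt_zero _ (by omega))) h3
    · rintro rfl
      refine ⟨⟨hB.edge_le_crit _ (by omega), hB.crit_le_edge _ (by omega)⟩,
        (hB.derivative_eval_eq_zero_iff _).2 ⟨_, hn, rfl⟩, hB.derivative_derivative_ne _ hn, ?_⟩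
      have := hB.one_le (n.val + 1) (by omega)
      rwa [Nat.add_sub_add_right, ← gapSign_eq] at this
  refine ⟨hiff, (hiff _).1 (Classical.epsilon_spec ⟨_, (hiff _).2 rfl⟩), ?_⟩
  rw [hνn]
  exact hμν _ hn

theorem existsUnique_gapCriticalPoint (n : Fin (m + 1 - 1)) :
    ∃! t, q.IsGapCriticalPoint n t := by
  obtain ⟨μ, κ, e, -, h⟩ := q.exists_bandStructure
  exact ⟨κ (n.val + 1), ((h n).1 _).2 rfl, fun t ht => ((h n).1 t).1 ht⟩

theorem isGapCriticalPoint_criticalPoint (n : Fin (m + 1 - 1)) :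
    q.IsGapCriticalPoint n (q.criticalPoint n) := by
  obtain ⟨μ, κ, e, -, h⟩ := q.exists_bandStructure
  exact ((h n).1 _).2 (h n).2.1

theorem cosh_slitHeight (n : Fin (m + 1 - 1)) :
    Real.cosh (q.slitHeight n) = gapSign n * q.lyapunov.eval (q.criticalPoint n) :=
  Real.cosh_arcosh (q.isGapCriticalPoint_criticalPoint n).2.2.2

theorem slitHeight_nonneg (n : Fin (m + 1 - 1)) : 0 ≤ q.slitHeight n :=
  Real.arcosh_nonneg (q.isGapCriticalPoint_criticalPoint n).2.2.2

theorem gapSign_mul_lyapunov_lt (n : Fin (m + 1 - 1))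
    (h : q.dirichletEigenvalue n ≠ q.criticalPoint n) :
    gapSign n * q.lyapunov.eval (q.dirichletEigenvalue n) <
      gapSign n * q.lyapunov.eval (q.criticalPoint n) := by
  obtain ⟨μ, κ, e, hB, hn⟩ := q.exists_bandStructure
  obtain ⟨-, hc, h1, h2⟩ := hn n
  have hm : n.val < m := n.2
  rw [gapSign_eq, hc]
  exact hB.eval_lt hm ((hB.crit_lt_zero _ (by omega)).trans h1).le
    (h2.trans (hB.zero_lt_crit _ (by omega))).le (hc ▸ h)

theorem sq_normingConstant_le (n : Fin (m + 1 - 1)) :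
    q.normingConstant n ^ 2 ≤ q.slitHeight n ^ 2 := by
  rw [sq_le_sq, ← Real.cosh_le_cosh, cosh_normingConstant, cosh_slitHeight]
  by_cases h : q.dirichletEigenvalue n = q.criticalPoint n
  · rw [h]
  · exact (q.gapSign_mul_lyapunov_lt n h).le

theorem sq_signedRemainder (n : Fin (m + 1 - 1)) :
    q.signedRemainder n ^ 2 = q.slitHeight n ^ 2 - q.normingConstant n ^ 2 := by
  have h := sub_nonneg.2 (q.sq_normingConstant_le n)
  rw [signedRemainder, mul_pow, Real.sq_sqrt h]
  rcases lt_trichotomy (q.criticalPoint n - q.dirichletEigenvalue n) 0 with h1 | h1 | h1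
  · rw [Real.sign_of_neg h1]; ring
  -- Here `Real.sign` returns `0`, which loses nothing because the radicand vanishes as well.
  · have h2 : Real.cosh (q.slitHeight n) = Real.cosh (q.normingConstant n) := by
      rw [cosh_normingConstant, cosh_slitHeight, sub_eq_zero.1 h1]
    have h3 : q.slitHeight n ^ 2 = q.normingConstant n ^ 2 :=
      (sq_eq_sq_iff_abs_eq_abs _ _).2
        (le_antisymm (Real.cosh_le_cosh.1 h2.le) (Real.cosh_le_cosh.1 h2.ge))
    rw [h3]; ring
  · rw [Real.sign_of_pos h1]; ring

theorem norm_marchenkoOstrovsky (n : Fin (m + 1 - 1)) :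
    ‖q.marchenkoOstrovsky n‖ = q.slitHeight n := by
  rw [EuclideanSpace.norm_eq, Fin.sum_univ_two]
  simp only [marchenkoOstrovsky, Real.norm_eq_abs, sq_abs]
  change √(q.normingConstant n ^ 2 + q.signedRemainder n ^ 2) = _
  rw [sq_signedRemainder, add_sub_cancel, Real.sqrt_sq (q.slitHeight_nonneg n)]

end

end JacobiData

end

/-! ### Divided differences of analytic functions. -/

noncomputable section

open Filter Topology

section DividedDifference

/-- The power series of the divided difference of a function with Taylor coefficients `c`. -/
def dividedDifferenceSeries (c : ℕ → ℝ) : FormalMultilinearSeries ℝ (ℝ × ℝ) ℝ := fun n =>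
  c (n + 1) • ∑ i ∈ Finset.range (n + 1),
    (ContinuousMultilinearMap.mkPiAlgebra ℝ (Fin n) ℝ).compContinuousLinearMap
      fun j => if j.val < i then ContinuousLinearMap.fst ℝ ℝ ℝ else ContinuousLinearMap.snd ℝ ℝ ℝ

theorem dividedDifferenceSeries_apply (c : ℕ → ℝ) (n : ℕ) (y : ℝ × ℝ) :
    (dividedDifferenceSeries c n fun _ => y) * (y.1 - y.2) =
      c (n + 1) * (y.1 ^ (n + 1) - y.2 ^ (n + 1)) := by
  have h : ∀ i ∈ Finset.range (n + 1), ((ContinuousMultilinearMap.mkPiAlgebra ℝ (Fin n)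
      ℝ).compContinuousLinearMap (fun j => if j.val < i then ContinuousLinearMap.fst ℝ ℝ ℝ else
        ContinuousLinearMap.snd ℝ ℝ ℝ)) (fun _ => y) = y.1 ^ i * y.2 ^ (n + 1 - 1 - i) := by
    intro i hi
    have hin : i ≤ n := Nat.lt_succ_iff.1 (Finset.mem_range.1 hi)
    rw [ContinuousMultilinearMap.compContinuousLinearMap_apply,
      ContinuousMultilinearMap.mkPiAlgebra_apply]
    have : ∀ j : Fin n, (if j.val < i then ContinuousLinearMap.fst ℝ ℝ ℝ else
        ContinuousLinearMap.snd ℝ ℝ ℝ) y = if j.val < i then y.1 else y.2 := by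
      intro j; split_ifs <;> rfl
    simp_rw [this]
    rw [Fin.prod_univ_eq_prod_range (fun j => if j < i then y.1 else y.2) n,
      Finset.prod_ite, Finset.prod_const, Finset.prod_const]
    congr 2
    · rw [show (Finset.range n).filter (· < i) = Finset.range i by ext; simp; omega,
        Finset.card_range]
    · rw [show (Finset.range n).filter (fun x => ¬ x < i) = Finset.Ico i n by
        ext; simp; omega, Nat.card_Ico]
      rfl
  rw [dividedDifferenceSeries, smul_apply, sum_apply,
    Finset.sum_congr rfl h, smul_eq_mul, mul_assoc, geom_sum₂_mul]

theorem norm_dividedDifferenceSeries_le (c : ℕ → ℝ) (n : ℕ) :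
    ‖dividedDifferenceSeries c n‖ ≤ |c (n + 1)| * (n + 1) := by
  rw [dividedDifferenceSeries, norm_smul, Real.norm_eq_abs]
  refine mul_le_mul_of_nonneg_left ?_ (abs_nonneg _)
  refine (norm_sum_le _ _).trans ?_
  have : ∀ i ∈ Finset.range (n + 1), ‖(ContinuousMultilinearMap.mkPiAlgebra ℝ (Fin n)
      ℝ).compContinuousLinearMap (fun j => if j.val < i then ContinuousLinearMap.fst ℝ ℝ ℝ else
        ContinuousLinearMap.snd ℝ ℝ ℝ)‖ ≤ 1 := by
    intro i _
    refine (ContinuousMultilinearMap.norm_compContinuousLinearMap_le _ _).trans ?_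
    rw [ContinuousMultilinearMap.norm_mkPiAlgebra, one_mul]
    refine Finset.prod_le_one (fun _ _ => norm_nonneg _) fun j _ => ?_
    split_ifs
    · exact ContinuousLinearMap.norm_fst_le ℝ ℝ ℝ
    · exact ContinuousLinearMap.norm_snd_le ℝ ℝ ℝ
  refine (Finset.sum_le_card_nsmul _ _ 1 this).trans ?_
  simp

/-- Each power in the Taylor series is divided by `y.1 - y.2` through the geometric sum, which
yields a two-variable power series converging near the diagonal point. -/
theorem AnalyticAt.exists_dividedDifference_self {f : ℝ → ℝ} {z : ℝ} (hf : AnalyticAt ℝ f z) :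
    ∃ D : ℝ × ℝ → ℝ, AnalyticAt ℝ D (z, z) ∧ D (z, z) = deriv f z ∧
      ∀ᶠ y in 𝓝 (z, z), f y.1 - f y.2 = (y.1 - y.2) * D y := by
  obtain ⟨p, hp⟩ := hf
  set q := dividedDifferenceSeries p.coeff
  obtain ⟨r, hr0, hr⟩ := ENNReal.lt_iff_exists_nnreal_btwn.1 hp.radius_pos
  have hr0 : 0 < r := by simpa using hr0
  obtain ⟨K, hK, hbound⟩ := p.norm_mul_pow_le_of_lt_radius hr
  have hq : 0 < q.radius := by
    -- Halving `r` pays for the `n + 1` monomials of degree `n`, since `n + 1 ≤ 2 ^ n`.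
    refine lt_of_lt_of_le ?_ (q.le_radius_of_bound (K / r) (r := r / 2) fun n => ?_)
    · simpa using hr0.ne'
    · have h1 := hbound (n + 1)
      rw [FormalMultilinearSeries.norm_apply_eq_norm_coef, Real.norm_eq_abs] at h1
      have h2 : ((n : ℝ) + 1) ≤ 2 ^ n := by exact_mod_cast Nat.lt_two_pow_self
      have hr' : (0 : ℝ) < r := hr0
      rw [le_div_iff₀ hr']
      push_cast
      calc ‖q n‖ * (r / 2 : ℝ) ^ n * r
          ≤ (|p.coeff (n + 1)| * (n + 1)) * (r / 2 : ℝ) ^ n * r := by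
            gcongr; exact norm_dividedDifferenceSeries_le _ _
        _ = (|p.coeff (n + 1)| * (r : ℝ) ^ (n + 1)) * ((n + 1) / 2 ^ n) := by
            rw [div_pow]; ring
        _ ≤ K * 1 := by
            gcongr
            exact (div_le_one (by positivity)).2 h2
        _ = K := mul_one K
  have hsum := q.hasFPowerSeriesOnBall hq
  refine ⟨fun y => q.sum (y - (z, z)), ?_, ?_, ?_⟩
  · have h1 : AnalyticAt ℝ q.sum ((z, z) - (z, z)) := by
      rw [sub_self]; exact hsum.analyticAt
    exact h1.comp (f := fun y => y - (z, z)) (by fun_prop)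
  · have h1 : q.sum 0 = q 0 fun _ => 0 := (hsum.coeff_zero _).symm
    have h2 : (q 0 fun _ => 0) = p.coeff 1 := by
      simp [q, dividedDifferenceSeries]
    rw [hp.deriv]
    simp only [sub_self]
    rw [h1, h2]
    rfl
  · have hmem : ∀ᶠ y in 𝓝 ((z, z) : ℝ × ℝ), y - (z, z) ∈ Metric.eball (0 : ℝ × ℝ) q.radius := by
      have hc : Tendsto (fun y : ℝ × ℝ => y - (z, z)) (𝓝 (z, z)) (𝓝 0) := by
        have : Continuous fun y : ℝ × ℝ => y - (z, z) := by fun_prop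
        simpa using this.tendsto (z, z)
      exact hc.eventually (Metric.eball_mem_nhds 0 hq)
    have hpf := hasFPowerSeriesAt_iff'.1 hp
    have h1 := continuous_fst.tendsto ((z, z) : ℝ × ℝ) |>.eventually hpf
    have h2 := continuous_snd.tendsto ((z, z) : ℝ × ℝ) |>.eventually hpf
    filter_upwards [hmem, h1, h2] with y hy h1 h2
    have h3 := (hsum.hasSum hy).mul_right (y.1 - y.2)
    rw [zero_add] at h3
    have h4 := h1.sub h2
    have h5 : HasSum (fun n => (y.1 - z) ^ (n + 1) • p.coeff (n + 1)
        - (y.2 - z) ^ (n + 1) • p.coeff (n + 1)) (f y.1 - f y.2) := by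
      simpa using (hasSum_nat_add_iff' 1).2 h4
    refine h5.unique ?_
    rw [mul_comm (y.1 - y.2)]
    have h6 : (fun n => (q n fun _ => y - (z, z)) * (y.1 - y.2)) = fun n =>
        (y.1 - z) ^ (n + 1) • p.coeff (n + 1) - (y.2 - z) ^ (n + 1) • p.coeff (n + 1) := by
      ext n
      have := dividedDifferenceSeries_apply p.coeff n (y - (z, z))
      simp only [Prod.fst_sub, Prod.snd_sub, sub_sub_sub_cancel_right] at this
      rw [this, smul_eq_mul, smul_eq_mul]
      ring
    rwa [h6] at h3

theorem AnalyticAt.exists_dividedDifference {f : ℝ → ℝ} {u v : ℝ} (hu : AnalyticAt ℝ f u)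
    (hv : AnalyticAt ℝ f v) :
    ∃ D : ℝ × ℝ → ℝ, AnalyticAt ℝ D (u, v) ∧
      D (u, v) = (if u = v then deriv f u else (f u - f v) / (u - v)) ∧
      ∀ᶠ y in 𝓝 (u, v), f y.1 - f y.2 = (y.1 - y.2) * D y := by
  by_cases h : u = v
  · subst h
    simpa using hu.exists_dividedDifference_self
  · refine ⟨fun y => (f y.1 - f y.2) / (y.1 - y.2), ?_, by simp [h], ?_⟩
    · refine AnalyticAt.div ?_ (analyticAt_fst.sub analyticAt_snd) (sub_ne_zero.2 h)
      have h1 : AnalyticAt ℝ (fun y : ℝ × ℝ => f y.1) (u, v) :=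
        AnalyticAt.comp (g := f) (f := Prod.fst) (x := (u, v)) hu analyticAt_fst
      have h2 : AnalyticAt ℝ (fun y : ℝ × ℝ => f y.2) (u, v) :=
        AnalyticAt.comp (g := f) (f := Prod.snd) (x := (u, v)) hv analyticAt_snd
      exact h1.sub h2
    · have : ∀ᶠ y in 𝓝 ((u, v) : ℝ × ℝ), y.1 ≠ y.2 :=
        (isOpen_ne_fun continuous_fst continuous_snd).mem_nhds h
      filter_upwards [this] with y hy
      rw [mul_div_cancel₀ _ (sub_ne_zero.2 hy)]

end DividedDifference

/-! ### The analytic continuation of `arcosh²` through `1`. -/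

section ArcoshSq

/-- The power series `∑ z ^ k / (2 k)!`, that is `cosh √z`. -/
def coshSqrt : ℝ → ℝ := FormalMultilinearSeries.ofScalarsSum (fun k => ((2 * k).factorial : ℝ)⁻¹)

theorem hasFPowerSeriesAt_coshSqrt : HasFPowerSeriesAt coshSqrt
    (FormalMultilinearSeries.ofScalars ℝ fun k => ((2 * k).factorial : ℝ)⁻¹) 0 := by
  have hr : (FormalMultilinearSeries.ofScalars ℝ fun k => ((2 * k).factorial : ℝ)⁻¹).radius = ⊤ := by
    refine FormalMultilinearSeries.ofScalars_radius_eq_top_of_tendsto _ _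
      (Eventually.of_forall fun n => by positivity) ?_
    have h : Tendsto (fun n : ℕ => ((n : ℝ) + 1)⁻¹) atTop (𝓝 0) := by
      simpa using tendsto_one_div_add_atTop_nhds_zero_nat (𝕜 := ℝ)
    refine squeeze_zero (fun _ => by positivity) (fun n => ?_) h
    rw [Nat.succ_eq_add_one, show 2 * (n + 1) = 2 * n + 1 + 1 by ring, Nat.factorial_succ,
      Nat.factorial_succ]
    rw [norm_inv, norm_inv, div_eq_mul_inv, inv_inv, Real.norm_of_nonneg (by positivity),
      Real.norm_of_nonneg (by positivity)]
    push_cast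
    have : (0 : ℝ) < (2 * n).factorial := by positivity
    field_simp
    nlinarith
  exact (FormalMultilinearSeries.hasFPowerSeriesOnBall _ (by rw [hr]; simp)).hasFPowerSeriesAt

theorem coshSqrt_eq_tsum (z : ℝ) : coshSqrt z = ∑' k : ℕ, ((2 * k).factorial : ℝ)⁻¹ * z ^ k := by
  rw [coshSqrt, FormalMultilinearSeries.ofScalarsSum_eq_tsum]
  simp

theorem coshSqrt_sq (x : ℝ) : coshSqrt (x ^ 2) = Real.cosh x := by
  rw [coshSqrt_eq_tsum, ← (Real.hasSum_cosh x).tsum_eq]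
  congr 1; ext k
  rw [← pow_mul]; ring

theorem coshSqrt_neg_sq (x : ℝ) : coshSqrt (-x ^ 2) = Real.cos x := by
  rw [coshSqrt_eq_tsum, ← (Real.hasSum_cos x).tsum_eq]
  congr 1; ext k
  rw [neg_pow, ← pow_mul]; ring

theorem coshSqrt_zero : coshSqrt 0 = 1 := by
  simpa using coshSqrt_sq 0

theorem hasDerivAt_coshSqrt_zero : HasDerivAt coshSqrt (1 / 2) 0 := by
  have h := hasFPowerSeriesAt_coshSqrt.hasDerivAt
  convert! h using 1
  simp

/-- `arcosh²`, continued analytically to the left of `1`. -/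
def arcoshSq (u : ℝ) : ℝ := if 1 ≤ u then Real.arcosh u ^ 2 else -Real.arccos u ^ 2

theorem arcoshSq_of_one_le {u : ℝ} (hu : 1 ≤ u) : arcoshSq u = Real.arcosh u ^ 2 := if_pos hu

theorem eventually_arcoshSq_coshSqrt : ∀ᶠ z in 𝓝 (0 : ℝ), arcoshSq (coshSqrt z) = z := by
  -- This keeps `√(-z)` inside `[0, π]`, where `arccos` inverts `cos`.
  have h : ∀ᶠ z in 𝓝 (0 : ℝ), -1 < z := lt_mem_nhds (by norm_num)
  filter_upwards [h] with z hz
  rcases le_or_gt 0 z with h0 | h0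
  · have h1 : coshSqrt z = Real.cosh √z := by rw [← coshSqrt_sq, Real.sq_sqrt h0]
    rw [h1, arcoshSq_of_one_le (Real.one_le_cosh _), Real.arcosh_cosh (Real.sqrt_nonneg _),
      Real.sq_sqrt h0]
  · have h1 : coshSqrt z = Real.cos √(-z) := by
      rw [← coshSqrt_neg_sq, Real.sq_sqrt (by linarith), neg_neg]
    have h2 : 0 < √(-z) := Real.sqrt_pos.2 (by linarith)
    have h3 : √(-z) ≤ Real.pi := by
      have : √(-z) ≤ 1 := Real.sqrt_le_one.2 (by linarith)
      linarith [Real.pi_gt_three]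
    have h4 : Real.cos √(-z) < 1 := by
      have := Real.cos_lt_cos_of_nonneg_of_le_pi le_rfl h3 h2
      rwa [Real.cos_zero] at this
    rw [h1, arcoshSq, if_neg h4.not_ge, Real.arccos_cos h2.le h3, Real.sq_sqrt (by linarith),
      neg_neg]

/-- At `1`, where `arcosh` has a square-root singularity, `arcoshSq` is the local inverse of the
entire function `cosh √z`, whose derivative at `0` is `1 / 2`. -/
theorem analyticAt_arcoshSq {u : ℝ} (hu : 1 ≤ u) : AnalyticAt ℝ arcoshSq u := by
  rcases hu.eq_or_lt with rfl | hu
  · have h := analyticAt_comp_iff_of_deriv_ne_zero (g := arcoshSq)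
      hasFPowerSeriesAt_coshSqrt.analyticAt
      (by rw [hasDerivAt_coshSqrt_zero.deriv]; norm_num)
    rw [coshSqrt_zero] at h
    refine h.1 (analyticAt_id.congr ?_)
    filter_upwards [eventually_arcoshSq_coshSqrt] with z hz using hz.symm
  · have h : AnalyticAt ℝ (fun u => Real.arcosh u ^ 2) u :=
      (Real.analyticOnNhd_arcosh (s := Set.Ioi 1) subset_rfl u hu).pow 2
    refine h.congr ?_
    filter_upwards [lt_mem_nhds hu] with v hv using (arcoshSq_of_one_le hv.le).symm

theorem deriv_arcoshSq_pos {u : ℝ} (hu : 1 ≤ u) : 0 < deriv arcoshSq u := by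
  have hd := (analyticAt_arcoshSq hu).differentiableAt.hasDerivAt
  rcases hu.eq_or_lt with rfl | hu
  · rw [← coshSqrt_zero] at hd
    have h1 := hd.comp (0 : ℝ) hasDerivAt_coshSqrt_zero
    have h2 : HasDerivAt (arcoshSq ∘ coshSqrt) 1 0 :=
      (hasDerivAt_id (0 : ℝ)).congr_of_eventuallyEq eventually_arcoshSq_coshSqrt
    have h3 := h1.unique h2
    rw [coshSqrt_zero] at h3
    linarith
  · have h1 : HasDerivAt arcoshSq _ u := ((Real.hasDerivAt_arcosh hu).pow 2).congr_of_eventuallyEq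
      (by filter_upwards [lt_mem_nhds hu] with v hv using arcoshSq_of_one_le hv.le)
    rw [h1.deriv]
    have h2 := Real.arcosh_pos hu
    have h3 : 0 < √(u ^ 2 - 1) := Real.sqrt_pos.2 (by nlinarith)
    positivity

theorem arcoshSq_lt {u v : ℝ} (hu : 1 ≤ u) (huv : u < v) : arcoshSq u < arcoshSq v := by
  rw [arcoshSq_of_one_le hu, arcoshSq_of_one_le (hu.trans huv.le)]
  have := (Real.arcosh_lt_arcosh (by linarith) (by linarith)).2 huv
  nlinarith [Real.arcosh_nonneg hu]

/-- Positivity is the positive derivative on the diagonal and strict monotonicity off it. -/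
theorem exists_dividedDifference_arcoshSq {u v : ℝ} (hu : 1 ≤ u) (hv : 1 ≤ v) :
    ∃ D : ℝ × ℝ → ℝ, AnalyticAt ℝ D (u, v) ∧ 0 < D (u, v) ∧
      ∀ᶠ y in 𝓝 (u, v), arcoshSq y.1 - arcoshSq y.2 = (y.1 - y.2) * D y := by
  obtain ⟨D, hD, hD0, h⟩ :=
    (analyticAt_arcoshSq hu).exists_dividedDifference (analyticAt_arcoshSq hv)
  refine ⟨D, hD, ?_, h⟩
  rw [hD0]
  split_ifs with huv
  · exact deriv_arcoshSq_pos hu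
  · rcases Ne.lt_or_gt huv with h | h
    · exact div_pos_of_neg_of_neg (sub_neg.2 (arcoshSq_lt hu h)) (sub_neg.2 h)
    · exact div_pos (sub_pos.2 (arcoshSq_lt hv h)) (sub_pos.2 h)

end ArcoshSq

/-! ### Analytic dependence of simple roots on parameters. -/

section Roots

theorem StrictMono.eq_of_forall_exists_eq {m : ℕ} {x y : Fin m → ℝ} (hx : StrictMono x)
    (hy : StrictMono y) (h : ∀ k, ∃ j, y j = x k) : x = y := by
  refine (StrictMono.range_inj hx hy).1 (Set.Subset.antisymm ?_ ?_)
  · rintro _ ⟨k, rfl⟩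
    exact h k
  · choose σ hσ using h
    have hinj : Function.Injective σ := fun a b hab => hx.injective (by rw [← hσ, hab, hσ])
    rintro _ ⟨j, rfl⟩
    obtain ⟨k, rfl⟩ := Finite.surjective_of_injective hinj j
    exact ⟨k, (hσ k).symm⟩

variable {E : Type*} [NormedAddCommGroup E] [NormedSpace ℝ E]

theorem AnalyticAt.eval_polynomial {p : E → ℝ[X]} {x : E → ℝ} {q₀ : E} {M : ℕ}
    (hp : ∀ k, AnalyticAt ℝ (fun q => (p q).coeff k) q₀) (hdeg : ∀ q, (p q).natDegree ≤ M)
    (hx : AnalyticAt ℝ x q₀) : AnalyticAt ℝ (fun q => (p q).eval (x q)) q₀ := by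
  simp_rw [fun q => eval_eq_sum_range' (Nat.lt_succ_of_le (hdeg q)) (x q)]
  exact Finset.analyticAt_fun_sum _ fun k _ => (hp k).mul (hx.pow k)

variable [CompleteSpace E]

/-- The implicit function theorem for `(q, t) ↦ p_q(t)`. -/
theorem exists_analyticAt_root {p : E → ℝ[X]} {q₀ : E} {t₀ : ℝ} {M : ℕ}
    (hp : ∀ k, AnalyticAt ℝ (fun q => (p q).coeff k) q₀) (hdeg : ∀ q, (p q).natDegree ≤ M)
    (h0 : (p q₀).eval t₀ = 0) (h1 : (derivative (p q₀)).eval t₀ ≠ 0) :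
    ∃ g : E → ℝ, AnalyticAt ℝ g q₀ ∧ g q₀ = t₀ ∧ ∀ᶠ q in 𝓝 q₀, (p q).eval (g q) = 0 := by
  set f : E × ℝ → ℝ := fun y => (p y.1).eval y.2
  have hf : AnalyticAt ℝ f (q₀, t₀) := by
    refine AnalyticAt.eval_polynomial (p := fun y : E × ℝ => p y.1) (fun k => ?_)
      (fun y => hdeg y.1) analyticAt_snd
    exact AnalyticAt.comp (g := fun q => (p q).coeff k) (f := Prod.fst) (x := (q₀, t₀)) (hp k)
      analyticAt_fst
  have hfc : ContDiffAt ℝ ⊤ f (q₀, t₀) := hf.contDiffAt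
  have hd : (fderiv ℝ f (q₀, t₀) ∘L .inr ℝ E ℝ) 1 = (derivative (p q₀)).eval t₀ := by
    have h2 : HasDerivAt (fun t : ℝ => ((q₀, t) : E × ℝ)) (0, 1) t₀ :=
      (hasDerivAt_const t₀ q₀).prodMk (hasDerivAt_id t₀)
    have h3 := hf.differentiableAt.hasFDerivAt.comp_hasDerivAt t₀ h2
    exact h3.unique ((p q₀).hasDerivAt t₀)
  have hinv : (fderiv ℝ f (q₀, t₀) ∘L .inr ℝ E ℝ).IsInvertible := by
    refine ⟨ContinuousLinearEquiv.unitsEquivAut ℝ (Units.mk0 _ h1), ?_⟩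
    ext
    rw [hd]
    simp
  refine ⟨hfc.implicitFunction (by simp) hinv,
    (hfc.contDiffAt_implicitFunction (by simp) hinv).analyticAt,
    hfc.implicitFunction_apply_self (by simp) hinv, ?_⟩
  filter_upwards [hfc.eventually_apply_implicitFunction (by simp) hinv] with q hq
  rw [← h0]
  exact hq

/-- The ordered zeros of a polynomial with simple zeros depend analytically on parameters. -/
theorem analyticAt_ordered_root {m M : ℕ} {p : E → ℝ[X]} {ρ : Fin m → E → ℝ} {q₀ : E}
    (hp : ∀ k, AnalyticAt ℝ (fun q => (p q).coeff k) q₀) (hdeg : ∀ q, (p q).natDegree ≤ M)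
    (hρ : ∀ q, StrictMono fun k => ρ k q)
    (hroot : ∀ q t, (p q).eval t = 0 ↔ ∃ k, ρ k q = t)
    (hsimple : ∀ k, (derivative (p q₀)).eval (ρ k q₀) ≠ 0) (k : Fin m) :
    AnalyticAt ℝ (ρ k) q₀ := by
  choose g hg hg0 hgr using fun k =>
    exists_analyticAt_root hp hdeg ((hroot q₀ _).2 ⟨k, rfl⟩) (hsimple k)
  refine (hg k).congr ?_
  -- The implicit branches stay ordered near `q₀`; being `m` increasing roots among exactly `m`,
  -- they are the sorted ones.
  have h1 : ∀ᶠ q in 𝓝 q₀, ∀ i j, i < j → g i q < g j q := by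
    refine eventually_all.2 fun i => eventually_all.2 fun j => ?_
    by_cases hij : i < j
    · have : ∀ᶠ q in 𝓝 q₀, g i q < g j q :=
        (hg i).continuousAt.eventually_lt (hg j).continuousAt (by
          rw [hg0, hg0]; exact hρ q₀ hij)
      filter_upwards [this] with q hq _ using hq
    · exact Eventually.of_forall fun q h => absurd h hij
  filter_upwards [h1, eventually_all.2 hgr] with q hq hqr
  exact congrFun (StrictMono.eq_of_forall_exists_eq (x := fun k => g k q) (fun i j => hq i j)
    (hρ q) fun k => (hroot q _).1 (hqr k)) k

end Roots

end

/-! ### Analyticity of the Marchenko–Ostrovsky map. -/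

noncomputable section

open Filter Topology

theorem Real.abs_mul_sign (x : ℝ) : |x| * Real.sign x = x := by
  rcases lt_trichotomy x 0 with h | rfl | h
  · rw [abs_of_neg h, Real.sign_of_neg h]; ring
  · simp
  · rw [abs_of_pos h, Real.sign_of_pos h, mul_one]

/-- The second order remainder quotient `(p t - p s - (t - s) p' s) / (t - s)²`, for polynomials of
degree at most `M + 1`. -/
def Polynomial.secondQuotient (M : ℕ) (p : ℝ[X]) (s t : ℝ) : ℝ :=
  ∑ k ∈ Finset.range M, (hasseDeriv (k + 2) p).eval s * (t - s) ^ k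

theorem Polynomial.eval_eq_add_secondQuotient {M : ℕ} {p : ℝ[X]} (hp : p.natDegree ≤ M + 1)
    (s t : ℝ) : p.eval t =
      p.eval s + (t - s) * (derivative p).eval s + (t - s) ^ 2 * p.secondQuotient M s t := by
  have h : p.eval t = (taylor s p).eval (t - s) := by rw [taylor_eval_sub]
  rw [h, eval_eq_sum_range' (n := M + 2) (by rw [natDegree_taylor]; omega),
    Finset.sum_range_succ', Finset.sum_range_succ', secondQuotient, Finset.mul_sum]
  simp_rw [taylor_coeff]
  simp only [zero_add, hasseDeriv_one, hasseDeriv_zero, LinearMap.id_coe, id_eq]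
  have : ∀ k, (hasseDeriv (k + 1 + 1) p).eval s * (t - s) ^ (k + 1 + 1) =
      (t - s) ^ 2 * ((hasseDeriv (k + 2) p).eval s * (t - s) ^ k) := fun k => by ring
  simp_rw [this]
  ring

theorem Polynomial.two_mul_secondQuotient_self {M : ℕ} (hM : 0 < M) (p : ℝ[X]) (s : ℝ) :
    2 * p.secondQuotient M s s = (derivative (derivative p)).eval s := by
  obtain ⟨M, rfl⟩ := Nat.exists_eq_succ_of_ne_zero hM.ne'
  rw [secondQuotient, Finset.sum_range_succ']
  have h := congrArg (fun f => (f p).eval s) (factorial_smul_hasseDeriv (R := ℝ) (k := 2))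
  simp only [LinearMap.smul_apply, eval_smul, Function.iterate_succ, Function.iterate_zero,
    Function.comp_apply, id_eq] at h
  simp [← h, Nat.factorial]

namespace JacobiData

variable {m : ℕ} [NeZero (m + 1)]

theorem natDegree_phi (q : JacobiData (m + 1)) (n : ℕ) : (q.phi (n + 1)).natDegree = n := by
  have := q.natDegree_monicPhi n
  rwa [← C_prodA_mul_phi, natDegree_C_mul (q.prodA_pos n).ne'] at this

theorem strictMono_dirichletEigenvalue (q : JacobiData (m + 1)) :
    StrictMono q.dirichletEigenvalue := by
  obtain ⟨ν, hν, h, -⟩ := q.exists_dirichlet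
  intro i j hij
  rw [h, h]
  exact hν i.2 j.2 hij

theorem eval_phi_eq_zero_iff (q : JacobiData (m + 1)) (t : ℝ) :
    (q.phi (m + 1)).eval t = 0 ↔ ∃ n, q.dirichletEigenvalue n = t := by
  obtain ⟨ν, -, h, -, -, h0⟩ := q.exists_dirichlet
  constructor
  · intro ht
    obtain ⟨k, hk, rfl⟩ := h0 t ht
    exact ⟨⟨k, hk⟩, h _⟩
  · rintro ⟨n, rfl⟩
    exact q.eval_phi_dirichletEigenvalue n

theorem derivative_phi_ne_zero (q : JacobiData (m + 1)) (n : Fin (m + 1 - 1)) :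
    (derivative (q.phi (m + 1))).eval (q.dirichletEigenvalue n) ≠ 0 := by
  obtain ⟨ν, hν, h, h0, -⟩ := q.exists_dirichlet
  rw [h]
  refine derivative_eval_ne_zero_of_strictMonoOn ?_ (q.natDegree_phi m).le hν h0 n.2
  intro h1
  have := q.C_prodA_mul_phi m
  rw [h1, mul_zero] at this
  exact (q.monic_monicPhi m).ne_zero this.symm

theorem strictMono_criticalPoint (q : JacobiData (m + 1)) : StrictMono q.criticalPoint := by
  obtain ⟨μ, κ, e, hB, h⟩ := q.exists_bandStructure
  intro i j hij
  have hj : j.val < m := j.2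
  have hij' : i.val < j.val := hij
  rw [(h i).2.1, (h j).2.1]
  exact hB.strictMonoOn_crit (by simp) (by simp) (by omega)

theorem eval_derivative_lyapunov_eq_zero_iff (q : JacobiData (m + 1)) (t : ℝ) :
    (derivative q.lyapunov).eval t = 0 ↔ ∃ n, q.criticalPoint n = t := by
  obtain ⟨μ, κ, e, hB, h⟩ := q.exists_bandStructure
  rw [hB.derivative_eval_eq_zero_iff]
  constructor
  · rintro ⟨k, hk, rfl⟩
    exact ⟨⟨k, hk⟩, (h _).2.1⟩
  · rintro ⟨n, rfl⟩
    exact ⟨n.val, n.2, (h n).2.1.symm⟩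

theorem derivative_lyapunov_criticalPoint (q : JacobiData (m + 1)) (n : Fin (m + 1 - 1)) :
    (derivative q.lyapunov).eval (q.criticalPoint n) = 0 :=
  (q.eval_derivative_lyapunov_eq_zero_iff _).2 ⟨n, rfl⟩

/-- The coordinate `x_n` as a continuous linear functional. -/
def xCLM (n : ZMod (m + 1)) : JacobiData (m + 1) →L[ℝ] ℝ :=
  LinearMap.toContinuousLinearMap
    { toFun := fun q => (q.fst : EuclideanSpace ℝ (ZMod (m + 1))) n
      map_add' := fun _ _ => rfl
      map_smul' := fun _ _ => rfl }

/-- The coordinate `b_n` as a continuous linear functional. -/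
def bCLM (n : ZMod (m + 1)) : JacobiData (m + 1) →L[ℝ] ℝ :=
  LinearMap.toContinuousLinearMap
    { toFun := fun q => q.b n
      map_add' := fun _ _ => rfl
      map_smul' := fun _ _ => rfl }

theorem analyticAt_b (n : ZMod (m + 1)) (q₀ : JacobiData (m + 1)) :
    AnalyticAt ℝ (fun q : JacobiData (m + 1) => q.b n) q₀ :=
  (bCLM n).analyticAt q₀

theorem analyticAt_a (n : ZMod (m + 1)) (q₀ : JacobiData (m + 1)) :
    AnalyticAt ℝ (fun q : JacobiData (m + 1) => q.a n) q₀ :=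
  ((xCLM n).analyticAt q₀).rexp

theorem analyticAt_coeff_solution (y₀ y₁ : ℝ[X]) (q₀ : JacobiData (m + 1)) (n : ℕ) :
    ∀ k, AnalyticAt ℝ (fun q : JacobiData (m + 1) => (q.solution y₀ y₁ n).coeff k) q₀ := by
  induction n using Nat.twoStepInduction with
  | zero => intro k; exact analyticAt_const
  | one => intro k; exact analyticAt_const
  | more n ih1 ih2 =>
    intro k
    have ha := analyticAt_a (n : ZMod (m + 1)) q₀
    have ha' := (analyticAt_a ((n + 1 : ℕ) : ZMod (m + 1)) q₀).inv (q₀.a_ne _)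
    have hb := analyticAt_b ((n + 1 : ℕ) : ZMod (m + 1)) q₀
    cases k with
    | zero =>
      simp only [solution, coeff_C_zero, coeff_sub, sub_mul, mul_coeff_zero, coeff_X_zero, zero_mul]
      exact ha'.mul ((analyticAt_const.sub (hb.mul (ih2 0))).sub (ha.mul (ih1 0)))
    | succ k =>
      simp only [solution, coeff_C_mul, coeff_sub, coeff_X_sub_C_mul_succ]
      exact ha'.mul (((ih2 k).sub (hb.mul (ih2 (k + 1)))).sub (ha.mul (ih1 (k + 1))))

theorem analyticAt_coeff_phi (n : ℕ) (q₀ : JacobiData (m + 1)) (k : ℕ) :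
    AnalyticAt ℝ (fun q : JacobiData (m + 1) => (q.phi n).coeff k) q₀ :=
  analyticAt_coeff_solution 0 1 q₀ n k

theorem analyticAt_coeff_lyapunov (q₀ : JacobiData (m + 1)) (k : ℕ) :
    AnalyticAt ℝ (fun q : JacobiData (m + 1) => q.lyapunov.coeff k) q₀ := by
  simp only [lyapunov, coeff_C_mul, coeff_add]
  exact analyticAt_const.mul ((analyticAt_coeff_phi _ q₀ k).add
    (analyticAt_coeff_solution 1 0 q₀ (m + 1) k))

theorem analyticAt_coeff_derivative_lyapunov (q₀ : JacobiData (m + 1)) (k : ℕ) :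
    AnalyticAt ℝ (fun q : JacobiData (m + 1) => (derivative q.lyapunov).coeff k) q₀ := by
  simp only [coeff_derivative]
  exact (analyticAt_coeff_lyapunov q₀ _).mul analyticAt_const

theorem natDegree_derivative_lyapunov_le (q : JacobiData (m + 1)) :
    (derivative q.lyapunov).natDegree ≤ m := by
  have := natDegree_derivative_le q.lyapunov
  rw [natDegree_lyapunov] at this
  simpa using this

theorem analyticAt_dirichletEigenvalue (n : Fin (m + 1 - 1)) (q₀ : JacobiData (m + 1)) :
    AnalyticAt ℝ (fun q : JacobiData (m + 1) => q.dirichletEigenvalue n) q₀ :=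
  analyticAt_ordered_root (ρ := fun n q => q.dirichletEigenvalue n)
    (analyticAt_coeff_phi (m + 1) q₀) (fun q => (q.natDegree_phi m).le)
    (fun q => q.strictMono_dirichletEigenvalue) (fun q => q.eval_phi_eq_zero_iff)
    q₀.derivative_phi_ne_zero n

theorem analyticAt_criticalPoint (n : Fin (m + 1 - 1)) (q₀ : JacobiData (m + 1)) :
    AnalyticAt ℝ (fun q : JacobiData (m + 1) => q.criticalPoint n) q₀ :=
  analyticAt_ordered_root (ρ := fun n q => q.criticalPoint n)
    (analyticAt_coeff_derivative_lyapunov q₀) natDegree_derivative_lyapunov_le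
    (fun q => q.strictMono_criticalPoint) (fun q => q.eval_derivative_lyapunov_eq_zero_iff)
    (fun n => (q₀.isGapCriticalPoint_criticalPoint n).2.2.1) n

theorem analyticAt_normingConstant (n : Fin (m + 1 - 1)) (q₀ : JacobiData (m + 1)) :
    AnalyticAt ℝ (fun q : JacobiData (m + 1) => q.normingConstant n) q₀ := by
  have h : AnalyticAt ℝ (fun q : JacobiData (m + 1) =>
      gapSign n * (q.phi (m + 2)).eval (q.dirichletEigenvalue n)) q₀ :=
    analyticAt_const.mul (AnalyticAt.eval_polynomial (analyticAt_coeff_phi (m + 2) q₀)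
      (fun q => (q.natDegree_phi (m + 1)).le) (analyticAt_dirichletEigenvalue n q₀))
  exact AnalyticAt.comp (g := Real.log) (x := q₀)
    (analyticAt_log (q₀.gapSign_mul_phi_pos n)) h

theorem analyticAt_eval_lyapunov {x : JacobiData (m + 1) → ℝ} {q₀ : JacobiData (m + 1)}
    (hx : AnalyticAt ℝ x q₀) : AnalyticAt ℝ (fun q => q.lyapunov.eval (x q)) q₀ :=
  AnalyticAt.eval_polynomial (analyticAt_coeff_lyapunov q₀) (fun q => q.natDegree_lyapunov.le) hx

/-- The quotient `(-1)^{N-n} (Δ(λ_n) - Δ(ν_n)) / (λ_n - ν_n)²`. -/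
def heightQuotient (q : JacobiData (m + 1)) (n : Fin (m + 1 - 1)) : ℝ :=
  -gapSign n * q.lyapunov.secondQuotient (m + 1) (q.criticalPoint n) (q.dirichletEigenvalue n)

theorem analyticAt_heightQuotient (n : Fin (m + 1 - 1)) (q₀ : JacobiData (m + 1)) :
    AnalyticAt ℝ (fun q : JacobiData (m + 1) => q.heightQuotient n) q₀ := by
  have hc := analyticAt_criticalPoint n q₀
  refine analyticAt_const.mul (Finset.analyticAt_fun_sum _ fun k _ => AnalyticAt.mul ?_
    (((analyticAt_dirichletEigenvalue n q₀).sub hc).pow k))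
  refine AnalyticAt.eval_polynomial (M := m + 1) (fun j => ?_) (fun q => ?_) hc
  · simp only [hasseDeriv_coeff]
    exact analyticAt_const.mul (analyticAt_coeff_lyapunov q₀ _)
  · have := natDegree_hasseDeriv_le q.lyapunov (k + 2)
    rw [natDegree_lyapunov] at this
    omega

/-- Taylor expansion of `Δ` at `λ_n`, where the linear term is absent. -/
theorem height_sub_eq (q : JacobiData (m + 1)) (n : Fin (m + 1 - 1)) :
    gapSign n * q.lyapunov.eval (q.criticalPoint n) -
      gapSign n * q.lyapunov.eval (q.dirichletEigenvalue n) =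
    (q.criticalPoint n - q.dirichletEigenvalue n) ^ 2 * q.heightQuotient n := by
  rw [eval_eq_add_secondQuotient (M := m + 1) (by rw [natDegree_lyapunov]; omega)
    (q.criticalPoint n) (q.dirichletEigenvalue n), derivative_lyapunov_criticalPoint,
    heightQuotient]
  ring

theorem heightQuotient_pos (q : JacobiData (m + 1)) (n : Fin (m + 1 - 1)) :
    0 < q.heightQuotient n := by
  by_cases h : q.dirichletEigenvalue n = q.criticalPoint n
  · obtain ⟨μ, κ, e, hB, hn⟩ := q.exists_bandStructure
    have h1 := hB.derivative_derivative_neg (k := n.val) n.2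
    rw [← gapSign_eq, ← (hn n).2.1, ← two_mul_secondQuotient_self (M := m + 1) (by omega)] at h1
    rw [heightQuotient, h]
    linarith
  · have h1 := sub_pos.2 (q.gapSign_mul_lyapunov_lt n h)
    rw [height_sub_eq] at h1
    exact pos_of_mul_pos_right h1 (sq_nonneg _)

theorem sq_slitHeight_eq (q : JacobiData (m + 1)) (n : Fin (m + 1 - 1)) :
    q.slitHeight n ^ 2 = arcoshSq (gapSign n * q.lyapunov.eval (q.criticalPoint n)) :=
  (arcoshSq_of_one_le (q.isGapCriticalPoint_criticalPoint n).2.2.2).symm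

theorem sq_normingConstant_eq (q : JacobiData (m + 1)) (n : Fin (m + 1 - 1)) :
    q.normingConstant n ^ 2 =
      arcoshSq (gapSign n * q.lyapunov.eval (q.dirichletEigenvalue n)) := by
  rw [← cosh_normingConstant, arcoshSq_of_one_le (Real.one_le_cosh _), ← Real.cosh_abs,
    Real.arcosh_cosh (abs_nonneg _), sq_abs]

theorem one_le_gapSign_mul_lyapunov (q : JacobiData (m + 1)) (n : Fin (m + 1 - 1)) :
    1 ≤ gapSign n * q.lyapunov.eval (q.dirichletEigenvalue n) := by
  rw [← cosh_normingConstant]; exact Real.one_le_cosh _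

/-- The radicand is a difference of values of `arcoshSq`, hence `(λ_n - ν_n)²` times an analytic
factor that is positive at `q₀`. Its root contributes `|λ_n - ν_n|`, and the sign in the definition
removes the absolute value. The factorisation also serves to differentiate `ψ_{2,n}` where `ν_n =
λ_n`. -/
theorem exists_signedRemainder_eq (n : Fin (m + 1 - 1)) (q₀ : JacobiData (m + 1)) :
    ∃ g : JacobiData (m + 1) → ℝ, AnalyticAt ℝ g q₀ ∧ 0 < g q₀ ∧
      ∀ᶠ q in 𝓝 q₀, q.signedRemainder n = (q.criticalPoint n - q.dirichletEigenvalue n) * g q := by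
  have hu : AnalyticAt ℝ (fun q : JacobiData (m + 1) =>
      gapSign n * q.lyapunov.eval (q.criticalPoint n)) q₀ :=
    analyticAt_const.mul (analyticAt_eval_lyapunov (analyticAt_criticalPoint n q₀))
  have hv : AnalyticAt ℝ (fun q : JacobiData (m + 1) =>
      gapSign n * q.lyapunov.eval (q.dirichletEigenvalue n)) q₀ :=
    analyticAt_const.mul (analyticAt_eval_lyapunov (analyticAt_dirichletEigenvalue n q₀))
  obtain ⟨D, hD, hD0, hDe⟩ := exists_dividedDifference_arcoshSq
    (q₀.isGapCriticalPoint_criticalPoint n).2.2.2 (q₀.one_le_gapSign_mul_lyapunov n)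
  have huv := hu.prod hv
  have hDq := AnalyticAt.comp (g := D) (x := q₀) hD huv
  have hpos := mul_pos (q₀.heightQuotient_pos n) hD0
  refine ⟨fun q => √(q.heightQuotient n * D (gapSign n * q.lyapunov.eval (q.criticalPoint n),
    gapSign n * q.lyapunov.eval (q.dirichletEigenvalue n))), ?_, Real.sqrt_pos.2 hpos, ?_⟩
  · exact AnalyticAt.comp (g := Real.sqrt)
      (Real.contDiffAt_sqrt (n := ⊤) hpos.ne').analyticAt
      ((analyticAt_heightQuotient n q₀).mul hDq)
  · filter_upwards [huv.continuousAt.eventually hDe] with q hq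
    rw [signedRemainder, sq_slitHeight_eq, sq_normingConstant_eq, hq, height_sub_eq, mul_assoc,
      Real.sqrt_mul (sq_nonneg _), Real.sqrt_sq_eq_abs, mul_right_comm,
      Real.abs_mul_sign]

theorem analyticAt_signedRemainder (n : Fin (m + 1 - 1)) (q₀ : JacobiData (m + 1)) :
    AnalyticAt ℝ (fun q : JacobiData (m + 1) => q.signedRemainder n) q₀ := by
  obtain ⟨g, hg, -, h⟩ := exists_signedRemainder_eq n q₀
  refine (((analyticAt_criticalPoint n q₀).sub
    (analyticAt_dirichletEigenvalue n q₀)).mul hg).congr ?_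
  filter_upwards [h] with q hq using hq.symm

theorem analyticAt_marchenkoOstrovsky (q₀ : JacobiData (m + 1)) :
    AnalyticAt ℝ (marchenkoOstrovsky (N := m + 1)) q₀ := by
  have h1 : ∀ n : Fin (m + 1 - 1), AnalyticAt ℝ (fun q : JacobiData (m + 1) =>
      (!₂[q.normingConstant n, q.signedRemainder n] : EuclideanSpace ℝ (Fin 2))) q₀ := by
    intro n
    have h2 : AnalyticAt ℝ (fun q : JacobiData (m + 1) =>
        (![q.normingConstant n, q.signedRemainder n] : Fin 2 → ℝ)) q₀ := by
      refine AnalyticAt.pi fun i => ?_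
      fin_cases i
      · exact analyticAt_normingConstant n q₀
      · exact analyticAt_signedRemainder n q₀
    exact ((PiLp.continuousLinearEquiv 2 ℝ fun _ : Fin 2 => ℝ).symm.toContinuousLinearMap.analyticAt
      _).comp h2
  exact ((PiLp.continuousLinearEquiv 2 ℝ fun _ : Fin (m + 1 - 1) =>
    EuclideanSpace ℝ (Fin 2)).symm.toContinuousLinearMap.analyticAt _).comp (AnalyticAt.pi h1)

end JacobiData

end

/-! ### Injectivity of the derivative. -/

noncomputable section

open Filter Topology

/-- The coefficients of the polynomials `p t` are differentiable at `t₀`, with derivatives the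
coefficients of `p'`. -/
def HasCoeffDerivAt (p : ℝ → ℝ[X]) (p' : ℝ[X]) (t₀ : ℝ) : Prop :=
  ∀ k, HasDerivAt (fun t => (p t).coeff k) (p'.coeff k) t₀

namespace HasCoeffDerivAt

variable {p : ℝ → ℝ[X]} {p' : ℝ[X]} {t₀ : ℝ} {M : ℕ}

theorem coeff_eq_zero (h : HasCoeffDerivAt p p' t₀) {k : ℕ} {c : ℝ} (hc : ∀ t, (p t).coeff k = c) :
    p'.coeff k = 0 := by
  have h1 := h k
  simp_rw [hc] at h1
  exact h1.unique (hasDerivAt_const _ _)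

theorem natDegree_le (h : HasCoeffDerivAt p p' t₀) (hdeg : ∀ t, (p t).natDegree ≤ M) :
    p'.natDegree ≤ M :=
  natDegree_le_iff_coeff_eq_zero.2 fun _ hk =>
    h.coeff_eq_zero fun t => coeff_eq_zero_of_natDegree_lt ((hdeg t).trans_lt hk)

theorem eval (h : HasCoeffDerivAt p p' t₀) (hdeg : ∀ t, (p t).natDegree ≤ M) {x : ℝ → ℝ} {x' : ℝ}
    (hx : HasDerivAt x x' t₀) :
    HasDerivAt (fun t => (p t).eval (x t))
      (p'.eval (x t₀) + (derivative (p t₀)).eval (x t₀) * x') t₀ := by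
  have h1 : ∀ t, (p t).eval (x t) = ∑ k ∈ Finset.range (M + 1), (p t).coeff k * x t ^ k :=
    fun t => eval_eq_sum_range' (Nat.lt_succ_of_le (hdeg t)) _
  simp_rw [h1]
  have h2 : HasDerivAt (fun t => ∑ k ∈ Finset.range (M + 1), (p t).coeff k * x t ^ k)
      (∑ k ∈ Finset.range (M + 1), (p'.coeff k * x t₀ ^ k +
        (p t₀).coeff k * (k * x t₀ ^ (k - 1) * x'))) t₀ :=
    HasDerivAt.fun_sum fun k _ => (h k).mul (hx.pow k)
  convert h2 using 1
  rw [Finset.sum_add_distrib,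
    ← eval_eq_sum_range' (Nat.lt_succ_of_le (h.natDegree_le hdeg)) (x t₀)]
  congr 1
  rw [derivative_eval, sum_over_range' _ _ (M + 1) (Nat.lt_succ_of_le (hdeg t₀)), Finset.sum_mul]
  · exact Finset.sum_congr rfl fun k _ => by ring
  · simp

theorem exists_of_differentiableAt (hp : ∀ k, DifferentiableAt ℝ (fun t => (p t).coeff k) t₀)
    (hdeg : ∀ t, (p t).natDegree ≤ M) : ∃ p', HasCoeffDerivAt p p' t₀ := by
  refine ⟨∑ k ∈ Finset.range (M + 1), monomial k (deriv (fun t => (p t).coeff k) t₀), fun k => ?_⟩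
  refine (hp k).hasDerivAt.congr_deriv ?_
  simp only [finsetSum_coeff, coeff_monomial, Finset.sum_ite_eq', Finset.mem_range]
  split_ifs with hk
  · rfl
  · have : (fun t => (p t).coeff k) = fun _ => 0 :=
      funext fun t => coeff_eq_zero_of_natDegree_lt ((hdeg t).trans_lt (by omega))
    rw [this, deriv_const]

theorem derivative (h : HasCoeffDerivAt p p' t₀) :
    HasCoeffDerivAt (fun t => Polynomial.derivative (p t)) (Polynomial.derivative p') t₀ := by
  intro k
  simp only [coeff_derivative]
  exact (h (k + 1)).mul_const _

end HasCoeffDerivAt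

theorem Polynomial.eq_zero_of_coeff_of_eval_fin {p : ℝ[X]} {m : ℕ} {ρ : Fin m → ℝ}
    (hρ : StrictMono ρ) (hp : ∀ k, m ≤ k → p.coeff k = 0) (h0 : ∀ k, p.eval (ρ k) = 0) : p = 0 := by
  refine eq_zero_of_degree_lt_of_eval_index_eq_zero Finset.univ (v := ρ) hρ.injective.injOn ?_ ?_
  · rw [Finset.card_univ, Fintype.card_fin, degree_lt_iff_coeff_zero]
    exact fun k hk => hp k (by exact_mod_cast hk)
  · simpa using h0

theorem DifferentiableAt.hasDerivAt_line {E : Type*} [NormedAddCommGroup E] [NormedSpace ℝ E]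
    {F : Type*} [NormedAddCommGroup F] [NormedSpace ℝ F] {f : E → F} {q : E}
    (hf : DifferentiableAt ℝ f q) (h : E) :
    HasDerivAt (fun t : ℝ => f (q + t • h)) (fderiv ℝ f q h) 0 := by
  have h1 : HasDerivAt (fun t : ℝ => q + t • h) h 0 := by
    simpa using ((hasDerivAt_id (0 : ℝ)).smul_const h).const_add q
  have h2 : HasFDerivAt f (fderiv ℝ f q) (q + (0 : ℝ) • h) := by simpa using hf.hasFDerivAt
  exact h2.comp_hasDerivAt 0 h1

namespace JacobiData

variable {m : ℕ} [NeZero (m + 1)]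

/-- If the derivatives of two consecutive monic solutions vanish, then so do those of the
coefficients connecting them and of the preceding solution. -/
theorem hasCoeffDerivAt_descend {γ : ℝ → JacobiData (m + 1)} {n : ℕ} {a' b' : ℝ}
    (ha : HasDerivAt (fun t => (γ t).a n) a' 0) (hb : HasDerivAt (fun t => (γ t).b (n + 1 : ℕ)) b' 0)
    (h1 : HasCoeffDerivAt (fun t => (γ t).monicPhi (n + 1)) 0 0)
    (h2 : HasCoeffDerivAt (fun t => (γ t).monicPhi (n + 2)) 0 0) :
    b' = 0 ∧ (0 < n → a' = 0 ∧ HasCoeffDerivAt (fun t => (γ t).monicPhi n) 0 0) := by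
  -- The recurrence solved for its last term; only the variation of `b` can contribute.
  have key : ∀ k, HasDerivAt (fun t => (γ t).a n ^ 2 * ((γ t).monicPhi n).coeff k)
      (-(b' * ((γ 0).monicPhi (n + 1)).coeff k)) 0 := by
    intro k
    have e : ∀ t, (γ t).a n ^ 2 * ((γ t).monicPhi n).coeff k =
        (X * (γ t).monicPhi (n + 1)).coeff k
          - (γ t).b (n + 1 : ℕ) * ((γ t).monicPhi (n + 1)).coeff k
          - ((γ t).monicPhi (n + 2)).coeff k := by
      intro t
      rw [monicPhi, sub_mul, coeff_sub, coeff_sub, coeff_C_mul, coeff_C_mul]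
      ring
    simp_rw [e]
    have hX : HasDerivAt (fun t => (X * (γ t).monicPhi (n + 1)).coeff k) 0 0 := by
      cases k with
      | zero => simpa using hasDerivAt_const _ _
      | succ k => simpa using h1 k
    exact ((hX.sub (hb.mul (h1 k))).sub (h2 k)).congr_deriv (by simp)
  -- At coefficient `n` the left side is identically zero by degree, while `monicPhi (n + 1)` has
  -- coefficient `1`.
  have hb0 : b' = 0 := by
    have h3 := key n
    have h4 : ∀ t, ((γ t).monicPhi n).coeff n = 0 := by
      intro t
      cases n with
      | zero => simp [monicPhi]
      | succ n => exact (γ t).coeff_monicPhi_of_lt n _ (by omega)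
    simp_rw [h4, mul_zero, coeff_monicPhi_self, mul_one] at h3
    have := h3.unique (hasDerivAt_const _ _)
    linarith
  refine ⟨hb0, fun hn => ?_⟩
  obtain ⟨n, rfl⟩ := Nat.exists_eq_succ_of_ne_zero hn.ne'
  simp only [hb0, zero_mul, neg_zero, Nat.succ_eq_add_one] at key ha ⊢
  have h3 : HasDerivAt (fun t => (γ t).a (n + 1 : ℕ) ^ 2) 0 0 := by
    simpa [coeff_monicPhi_self] using key n
  have h4 : a' = 0 := by
    have := (ha.pow 2).unique h3
    simpa [(γ 0).a_ne] using this
  refine ⟨h4, fun k => ?_⟩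
  have h5 := (key k).div h3 (pow_ne_zero 2 ((γ 0).a_ne _))
  have h6 : (fun t => ((γ t).monicPhi (n + 1)).coeff k) = fun t =>
      (γ t).a (n + 1 : ℕ) ^ 2 * ((γ t).monicPhi (n + 1)).coeff k / (γ t).a (n + 1 : ℕ) ^ 2 := by
    ext t
    rw [mul_div_cancel_left₀ _ (pow_ne_zero 2 ((γ t).a_ne _))]
  rw [h6]
  exact h5.congr_deriv (by simp)

/-- The descent through the recurrence never meets `a_N`; the remaining coordinate of `x` comes from
the zero sum. -/
theorem eq_zero_of_coordinates {h : JacobiData (m + 1)}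
    (hb : ∀ n ≤ m, h.b (n + 1 : ℕ) = 0) (hx : ∀ n, 0 < n → n ≤ m → xCLM (n : ℕ) h = 0) :
    h = 0 := by
  have hall : ∀ z : ZMod (m + 1), ∃ n ≤ m, ((n + 1 : ℕ) : ZMod (m + 1)) = z := by
    intro z
    refine ⟨(z - 1).val, Nat.lt_succ_iff.1 (ZMod.val_lt _), ?_⟩
    rw [Nat.cast_succ, ZMod.natCast_zmod_val, sub_add_cancel]
  have hsum : ∑ k ∈ Finset.range (m + 1), xCLM ((k + 1 : ℕ) : ZMod (m + 1)) h = 0 := by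
    rw [ZMod.sum_range_natCast_succ fun z : ZMod (m + 1) => xCLM z h]
    exact h.sum_x_eq_zero
  rw [Finset.sum_range_succ, Finset.sum_eq_zero fun k hk =>
    hx (k + 1) (by omega) (Finset.mem_range.1 hk), zero_add] at hsum
  have hx0 : ∀ z, xCLM z h = 0 := by
    intro z
    obtain ⟨n, hn, rfl⟩ := hall z
    rcases hn.lt_or_eq with hn | rfl
    · exact hx _ (by omega) hn
    · exact hsum
  have hb0 : ∀ z, h.b z = 0 := by
    intro z
    obtain ⟨n, hn, rfl⟩ := hall z
    exact hb n hn
  have h1 : h.fst = 0 := by ext z; exact hx0 z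
  have h2 : h.snd = 0 := by ext z; exact hb0 z
  exact WithLp.ofLp_injective 2 (Prod.ext h1 h2)

theorem hasDerivAt_b_line (q h : JacobiData (m + 1)) (n : ZMod (m + 1)) :
    HasDerivAt (fun t : ℝ => (q + t • h).b n) (h.b n) 0 := by
  have := (analyticAt_b n q).differentiableAt.hasDerivAt_line h
  rwa [show (fun q : JacobiData (m + 1) => q.b n) = bCLM n from rfl,
    ContinuousLinearMap.fderiv] at this

theorem hasDerivAt_a_line (q h : JacobiData (m + 1)) (n : ZMod (m + 1)) :
    HasDerivAt (fun t : ℝ => (q + t • h).a n) (q.a n * xCLM n h) 0 := by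
  have h1 := ((xCLM n).differentiableAt (x := q)).hasDerivAt_line h
  rw [ContinuousLinearMap.fderiv] at h1
  refine HasDerivAt.congr_deriv (f := fun t : ℝ => (q + t • h).a n) h1.exp ?_
  rw [zero_smul, add_zero]
  rfl

theorem eq_zero_of_hasCoeffDerivAt {q h : JacobiData (m + 1)}
    (h1 : HasCoeffDerivAt (fun t : ℝ => (q + t • h).monicPhi (m + 1)) 0 0)
    (h2 : HasCoeffDerivAt (fun t : ℝ => (q + t • h).monicPhi (m + 2)) 0 0) : h = 0 := by
  have key : ∀ j ≤ m, HasCoeffDerivAt (fun t : ℝ => (q + t • h).monicPhi (m - j + 1)) 0 0 ∧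
      HasCoeffDerivAt (fun t : ℝ => (q + t • h).monicPhi (m - j + 2)) 0 0 := by
    intro j
    induction j with
    | zero => exact fun _ => ⟨h1, h2⟩
    | succ j ih =>
      intro hj
      obtain ⟨h3, h4⟩ := ih (by omega)
      have h5 := hasCoeffDerivAt_descend (hasDerivAt_a_line q h _) (hasDerivAt_b_line q h _) h3 h4
      rw [show m - j = m - (j + 1) + 1 by omega] at h5 h3
      exact ⟨(h5.2 (by omega)).2, h3⟩
  have hkey : ∀ n ≤ m, _ := fun n hn => by
    have h3 := key (m - n) (by omega)
    rw [show m - (m - n) = n by omega] at h3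
    exact hasCoeffDerivAt_descend (hasDerivAt_a_line q h _) (hasDerivAt_b_line q h _) h3.1 h3.2
  refine eq_zero_of_coordinates (fun n hn => (hkey n hn).1) fun n hn0 hn => ?_
  have := ((hkey n hn).2 hn0).1
  simpa [q.a_ne] using this

theorem analyticAt_coeff_monicPhi (n : ℕ) (q₀ : JacobiData (m + 1)) (k : ℕ) :
    AnalyticAt ℝ (fun q : JacobiData (m + 1) => (q.monicPhi (n + 1)).coeff k) q₀ := by
  simp_rw [← C_prodA_mul_phi, coeff_C_mul]
  exact (Finset.analyticAt_fun_prod _ fun k _ => analyticAt_a _ q₀).mul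
    (analyticAt_coeff_phi _ q₀ k)

theorem hasDerivAt_coordinates {q h : JacobiData (m + 1)}
    (h0 : fderiv ℝ (marchenkoOstrovsky (N := m + 1)) q h = 0) (n : Fin (m + 1 - 1)) :
    HasDerivAt (fun t : ℝ => (q + t • h).normingConstant n) 0 0 ∧
      HasDerivAt (fun t : ℝ => (q + t • h).signedRemainder n) 0 0 := by
  have h1 := (analyticAt_marchenkoOstrovsky q).differentiableAt.hasDerivAt_line h
  rw [h0] at h1
  have h2 := (PiLp.proj 2 (𝕜 := ℝ) (fun _ : Fin (m + 1 - 1) => EuclideanSpace ℝ (Fin 2))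
    n).hasFDerivAt.comp_hasDerivAt (0 : ℝ) h1
  have h3 := fun i : Fin 2 => (EuclideanSpace.proj i :
    EuclideanSpace ℝ (Fin 2) →L[ℝ] ℝ).hasFDerivAt.comp_hasDerivAt (0 : ℝ) h2
  simp only [map_zero] at h3
  exact ⟨h3 0, h3 1⟩

theorem eq_zero_of_fderiv_eq_zero {q h : JacobiData (m + 1)}
    (h0 : fderiv ℝ (marchenkoOstrovsky (N := m + 1)) q h = 0) : h = 0 := by
  have hz : q + (0 : ℝ) • h = q := by simp
  -- derivatives of all the data along the line
  have hψ1 := fun n => (hasDerivAt_coordinates h0 n).1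
  have hψ2 := fun n => (hasDerivAt_coordinates h0 n).2
  have hν := fun n => (analyticAt_dirichletEigenvalue n q).differentiableAt.hasDerivAt_line h
  have hlam := fun n => (analyticAt_criticalPoint n q).differentiableAt.hasDerivAt_line h
  set ν' := fun n => fderiv ℝ (fun q : JacobiData (m + 1) => q.dirichletEigenvalue n) q h
  set lam' := fun n => fderiv ℝ (fun q : JacobiData (m + 1) => q.criticalPoint n) q h
  have hdegΔ : ∀ t : ℝ, (q + t • h).lyapunov.natDegree ≤ m + 1 :=
    fun t => (q + t • h).natDegree_lyapunov.le
  obtain ⟨Δ', hΔ'⟩ := HasCoeffDerivAt.exists_of_differentiableAt (t₀ := 0)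
    (p := fun t : ℝ => (q + t • h).lyapunov)
    (fun k => ((analyticAt_coeff_lyapunov q k).differentiableAt.hasDerivAt_line h).differentiableAt)
    hdegΔ
  obtain ⟨P', hP'⟩ := HasCoeffDerivAt.exists_of_differentiableAt (t₀ := 0)
    (p := fun t : ℝ => (q + t • h).monicPhi (m + 1)) (fun k =>
      ((analyticAt_coeff_monicPhi m q k).differentiableAt.hasDerivAt_line h).differentiableAt)
    (fun t => ((q + t • h).natDegree_monicPhi m).le)
  obtain ⟨R', hR'⟩ := HasCoeffDerivAt.exists_of_differentiableAt (t₀ := 0)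
    (p := fun t : ℝ => (q + t • h).monicPhi (m + 2)) (fun k =>
      ((analyticAt_coeff_monicPhi (m + 1) q k).differentiableAt.hasDerivAt_line h).differentiableAt)
    (fun t => ((q + t • h).natDegree_monicPhi (m + 1)).le)
  -- the Lyapunov function is stationary
  have hΔ0 : Δ' = 0 := by
    refine eq_zero_of_coeff_of_eval_fin q.strictMono_criticalPoint (fun k hk => ?_) fun n => ?_
    · have hk : m ≤ k := hk
      rcases hk.eq_or_lt with rfl | hk
      · exact hΔ'.coeff_eq_zero fun t => (q + t • h).coeff_lyapunov_pred
      · rcases (Nat.succ_le_of_lt hk).eq_or_lt with rfl | hk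
        · exact hΔ'.coeff_eq_zero fun t => (q + t • h).coeff_lyapunov_top
        · exact hΔ'.coeff_eq_zero fun t => (q + t • h).coeff_lyapunov_of_lt k hk
    -- The motion of `λ_n` does not contribute, as `Δ'(λ_n) = 0`.
    · have h1 := (hΔ'.eval hdegΔ (hlam n)).const_mul (gapSign n)
      simp only [hz, derivative_lyapunov_criticalPoint, zero_mul, add_zero] at h1
      have hu := (q.isGapCriticalPoint_criticalPoint n).2.2.2
      have h2 : HasDerivAt arcoshSq
          (deriv arcoshSq (gapSign n * q.lyapunov.eval (q.criticalPoint n)))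
          (gapSign n * (q + (0 : ℝ) • h).lyapunov.eval ((q + (0 : ℝ) • h).criticalPoint n)) := by
        rw [hz]; exact (analyticAt_arcoshSq hu).differentiableAt.hasDerivAt
      have h3 := h2.comp (0 : ℝ) h1
      -- The squared height is `ψ_{1,n}² + ψ_{2,n}²`, which is stationary. Since `arcoshSq` has
      -- nonzero derivative even at `1`, this passes to `Δ(λ_n)` for closed gaps as well.
      have h4 : (arcoshSq ∘ fun t : ℝ =>
          gapSign n * (q + t • h).lyapunov.eval ((q + t • h).criticalPoint n)) =
          fun t : ℝ => (q + t • h).normingConstant n ^ 2 + (q + t • h).signedRemainder n ^ 2 := by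
        ext t
        rw [Function.comp_apply, ← sq_slitHeight_eq, sq_signedRemainder]
        ring
      rw [h4] at h3
      have h5 := h3.unique (((hψ1 n).pow 2).add ((hψ2 n).pow 2))
      have h6 := (deriv_arcoshSq_pos hu).ne'
      have h7 : gapSign n ≠ 0 := by rw [gapSign_eq]; simp
      simpa [h6, h7] using h5
  -- the Dirichlet eigenvalues are stationary
  have hν0 : ∀ n, ν' n = 0 := by
    intro n
    -- Differentiate `cosh ψ_{1,n} = (-1)^{N-n} Δ(ν_n)`.
    have h1 : (derivative q.lyapunov).eval (q.dirichletEigenvalue n) * ν' n = 0 := by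
      have h1 := (hΔ'.eval hdegΔ (hν n)).const_mul (gapSign n)
      simp_rw [← cosh_normingConstant] at h1
      have h2 := h1.unique (hψ1 n).cosh
      have h7 : gapSign n ≠ 0 := by rw [gapSign_eq]; simp
      simpa [hΔ0, h7] using h2
    -- If `ν_n = λ_n` the previous identity is empty. Then `λ_n` is stationary because `Δ''(λ_n) ≠
    -- 0`, and `ψ_{2,n} = (λ_n - ν_n) g` with `g > 0` transfers this to `ν_n`.
    by_cases he : q.dirichletEigenvalue n = q.criticalPoint n
    · have h2 : lam' n = 0 := by
        have h3 := hΔ'.derivative.eval (fun t => (q + t • h).natDegree_derivative_lyapunov_le)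
          (hlam n)
        simp_rw [derivative_lyapunov_criticalPoint] at h3
        have h4 := h3.unique (hasDerivAt_const _ _)
        have h5 := (q.isGapCriticalPoint_criticalPoint n).2.2.1
        simpa [hΔ0, h5] using h4
      obtain ⟨g, hg, hg0, hge⟩ := exists_signedRemainder_eq n q
      have h3 := ((hlam n).sub (hν n)).mul (hg.differentiableAt.hasDerivAt_line h)
      have hline : Tendsto (fun t : ℝ => q + t • h) (𝓝 0) (𝓝 q) := by
        have : Continuous fun t : ℝ => q + t • h := by fun_prop
        simpa using this.tendsto 0
      have h4 := (h3.congr_of_eventuallyEq (hline.eventually hge)).unique (hψ2 n)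
      change (lam' n - ν' n) * _ + _ = 0 at h4
      simpa [he, h2, hg0.ne'] using h4
    · refine (mul_eq_zero.1 h1).resolve_left fun h2 => he ?_
      obtain ⟨μ, κ, e, hB, hn⟩ := q.exists_bandStructure
      rw [(hn n).2.1]
      exact hB.eq_of_derivative_eval_eq_zero n.2 (hn n).2.2.1 (hn n).2.2.2 h2
  have hP0 : P' = 0 := by
    refine eq_zero_of_coeff_of_eval_fin q.strictMono_dirichletEigenvalue (fun k hk => ?_) fun n => ?_
    · rcases (show m ≤ k from hk).eq_or_lt with rfl | hk
      · exact hP'.coeff_eq_zero fun t => (q + t • h).coeff_monicPhi_self _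
      · exact hP'.coeff_eq_zero fun t => (q + t • h).coeff_monicPhi_of_lt _ k hk
    · have h1 := hP'.eval (fun t => ((q + t • h).natDegree_monicPhi m).le) (hν n)
      have h2 : ∀ t : ℝ, ((q + t • h).monicPhi (m + 1)).eval
          ((q + t • h).dirichletEigenvalue n) = 0 := fun t => by
        rw [← C_prodA_mul_phi, eval_mul, eval_phi_dirichletEigenvalue, mul_zero]
      simp_rw [h2] at h1
      have h3 := h1.unique (hasDerivAt_const _ _)
      change _ + _ * ν' n = 0 at h3
      simpa [hν0] using h3
  -- The coefficients from degree `m` up are fixed, the one in degree `m` by `∑ b = 0`, and the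
  -- values at the stationary `ν_n` are `± exp ψ_{1,n}`.
  have hR0 : R' = 0 := by
    refine eq_zero_of_coeff_of_eval_fin q.strictMono_dirichletEigenvalue (fun k hk => ?_) fun n => ?_
    · rcases (show m ≤ k from hk).eq_or_lt with rfl | hk
      · exact hR'.coeff_eq_zero (c := 0) fun t => by rw [← phi_period, coeff_phi_pred]
      · rcases (Nat.succ_le_of_lt hk).eq_or_lt with rfl | hk
        · exact hR'.coeff_eq_zero fun t => (q + t • h).coeff_monicPhi_self _
        · exact hR'.coeff_eq_zero fun t => (q + t • h).coeff_monicPhi_of_lt _ k hk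
    · have h1 := hR'.eval (fun t => ((q + t • h).natDegree_monicPhi (m + 1)).le) (hν n)
      have h2 : ∀ t : ℝ, ((q + t • h).monicPhi (m + 2)).eval
          ((q + t • h).dirichletEigenvalue n) =
            gapSign n * Real.exp ((q + t • h).normingConstant n) := fun t => by
        rw [normingConstant, Real.exp_log (gapSign_mul_phi_pos _ n), phi_period, ← mul_assoc,
          gapSign_mul_self, one_mul]
      simp_rw [h2] at h1
      have h3 := h1.unique ((hψ1 n).exp.const_mul _)
      change _ + _ * ν' n = _ at h3
      simpa [hν0] using h3
  exact eq_zero_of_hasCoeffDerivAt (hP0 ▸ hP') (hR0 ▸ hR')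

end JacobiData

end

/-! ### Extremal estimates, the inverse problem, and the fibre over zero. -/

noncomputable section

theorem exists_mem_Icc_succ {κ : ℕ → ℝ} {t : ℝ} (n : ℕ) (h : t ∈ Set.Icc (κ 0) (κ (n + 1))) :
    ∃ k ≤ n, t ∈ Set.Icc (κ k) (κ (k + 1)) := by
  induction n with
  | zero => exact ⟨0, le_rfl, h⟩
  | succ n ih =>
    rcases le_total t (κ (n + 1)) with h1 | h1
    · obtain ⟨k, hk, hk'⟩ := ih ⟨h.1, h1⟩
      exact ⟨k, by omega, hk'⟩
    · exact ⟨n + 1, le_rfl, h1, h.2⟩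

theorem neg_one_pow_mul_prod_erase_pos {n i : ℕ} {y : ℕ → ℝ} (hy : StrictMonoOn y (Set.Iio (n + 1)))
    (hi : i < n + 1) :
    0 < (-1 : ℝ) ^ (n - i) * ∏ j ∈ (Finset.range (n + 1)).erase i, (y i - y j) := by
  -- The node `y i` is replaced by `y i - 1`, so that the factor to be erased equals `1`.
  have h := neg_one_pow_mul_prod_sub_pos (m := n + 1) (k := i + 1) (t := y i)
    (y := fun j => if j = i then y i - 1 else y j) hi (fun j hj => ?_) fun j hj hjn => ?_
  · rw [← Finset.mul_prod_erase _ _ (Finset.mem_range.2 hi), if_pos rfl, sub_sub_cancel, one_mul,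
      Nat.add_sub_add_right] at h
    rwa [Finset.prod_congr rfl fun j hj => by rw [if_neg (Finset.ne_of_mem_erase hj)]] at h
  · split_ifs with hji
    · linarith
    · exact hy (by simp; omega) (by simpa using hi) (by omega)
  · rw [if_neg (by omega)]
    exact hy (by simpa using hi) (by simpa using hjn) (by omega)

/-- A polynomial that is bounded by `C` on an interval of length `L` has leading coefficient
`O(C / L)`. -/
theorem Polynomial.length_mul_coeff_le {p : ℝ[X]} {n : ℕ} (hp : p.natDegree = n + 1) {C α β c : ℝ}
    (hC : 0 ≤ C) (hαβ : α < β) (hb : ∀ t ∈ Set.Icc α β, |p.eval t| ≤ C)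
    (hc : 0 < c) (hcp : c ≤ p.coeff (n + 1)) (hcC : c ≤ C) :
    c * (β - α) ≤ (n + 1) * (n + 2) * C := by
  set L := β - α
  have hL : 0 < L := sub_pos.2 hαβ
  set δ := L / (n + 1)
  have hn1 : (0 : ℝ) < n + 1 := by positivity
  have hδ : 0 < δ := div_pos hL hn1
  have hδL : δ * (n + 1) = L := div_mul_cancel₀ _ hn1.ne'
  -- With spacing `δ ≤ 1` the bound is immediate from `c ≤ C`. Otherwise Lagrange's formula at `n +
  -- 2` equally spaced nodes applies, with denominators at least `δ ^ (n + 1) ≥ δ`.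
  rcases le_or_gt δ 1 with h1 | h1
  · have : L ≤ n + 1 := by nlinarith
    have hnn : (0 : ℝ) ≤ n := by positivity
    calc c * L ≤ C * (n + 1) := by gcongr
      _ ≤ (n + 1) * (n + 2) * C := by nlinarith [mul_nonneg hC hn1.le]
  · have hinj : Set.InjOn (fun i : ℕ => α + δ * i) (Finset.range (n + 2)) := by
      intro i _ j _ hij
      have : δ * (i : ℝ) = δ * j := by simpa using hij
      exact_mod_cast mul_left_cancel₀ hδ.ne' this
    have hlag := Lagrange.coeff_eq_sum hinj (P := p)
      (by rw [Finset.card_range]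
          exact (natDegree_lt_iff_degree_lt (by rintro rfl; simp at hp)).1 (by omega))
    rw [Finset.card_range, show n + 2 - 1 = n + 1 by omega] at hlag
    have hterm : ∀ i ∈ Finset.range (n + 2), |p.eval (α + δ * i) /
        ∏ j ∈ (Finset.range (n + 2)).erase i, ((α + δ * i) - (α + δ * j))| ≤ C / δ := by
      intro i hi
      have hprod : δ ≤ |∏ j ∈ (Finset.range (n + 2)).erase i, ((α + δ * i) - (α + δ * j))| := by
        rw [Finset.abs_prod]
        calc δ ≤ δ ^ (n + 1) := le_self_pow₀ h1.le (by omega)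
          _ = ∏ _j ∈ (Finset.range (n + 2)).erase i, δ := by
              rw [Finset.prod_const, Finset.card_erase_of_mem hi, Finset.card_range]; rfl
          _ ≤ _ := by
              refine Finset.prod_le_prod (fun _ _ => hδ.le) fun j hj => ?_
              have hij : (i : ℤ) - j ≠ 0 := by
                have := Finset.ne_of_mem_erase hj; omega
              have h2 : (1 : ℝ) ≤ |(i : ℝ) - j| := by exact_mod_cast Int.one_le_abs hij
              rw [show α + δ * (i : ℝ) - (α + δ * j) = δ * (i - j) by ring, abs_mul,
                abs_of_pos hδ]
              nlinarith
      rw [abs_div]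
      refine div_le_div₀ hC (hb _ ⟨by nlinarith [(Nat.cast_nonneg i : (0 : ℝ) ≤ i)], ?_⟩) hδ hprod
      have : (i : ℝ) ≤ n + 1 := by exact_mod_cast Nat.lt_succ_iff.1 (Finset.mem_range.1 hi)
      have : δ * i ≤ δ * (n + 1) := by gcongr
      have : L = β - α := rfl
      linarith
    have h2 : c ≤ (n + 2) * (C / δ) := by
      calc c ≤ |p.coeff (n + 1)| := hcp.trans (le_abs_self _)
        _ ≤ ∑ i ∈ Finset.range (n + 2), C / δ := by
            rw [hlag]
            exact (Finset.abs_sum_le_sum_abs _ _).trans (Finset.sum_le_sum hterm)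
        _ = _ := by simp
    calc c * L ≤ ((n + 2) * (C / δ)) * L := by gcongr
      _ = _ := by rw [← hδL]; field_simp

namespace IsBandStructure

variable {D : ℝ[X]} {m : ℕ} {μ κ e : ℕ → ℝ}

theorem abs_eval_le (h : IsBandStructure D m μ κ e) {C : ℝ}
    (hC : ∀ k < m + 2, (-1) ^ (m + 1 - k) * D.eval (κ k) ≤ C) {t : ℝ}
    (ht : t ∈ Set.Icc (κ 0) (κ (m + 1))) : |D.eval t| ≤ C := by
  obtain ⟨k, hk, ht⟩ := exists_mem_Icc_succ m ht
  have hκ := (h.crit_lt_crit (k := k) (by omega)).le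
  have h1 := (h.strictMonoOn_eval k (by omega)).monotoneOn ⟨le_rfl, hκ⟩ ht ht.1
  have h2 := (h.strictMonoOn_eval k (by omega)).monotoneOn ht ⟨hκ, le_rfl⟩ ht.2
  have h3 := hC k (by omega)
  have h4 := hC (k + 1) (by omega)
  rw [neg_one_pow_succ_sub hk] at h3
  rw [Nat.add_sub_add_right] at h4
  have h5 : |D.eval t| = |(-1) ^ (m - k) * D.eval t| := by rw [abs_mul]; simp
  rw [h5, abs_le]
  constructor <;> linarith

theorem first_lt_zero (h : IsBandStructure D m μ κ e) {k : ℕ} (hk : k < m + 1) : κ 0 < μ k :=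
  lt_of_le_of_lt (h.strictMonoOn_crit.monotoneOn (by simp) (by simp; omega) (by omega))
    (h.crit_lt_zero k hk)

theorem zero_lt_last (h : IsBandStructure D m μ κ e) {k : ℕ} (hk : k < m + 1) : μ k < κ (m + 1) :=
  lt_of_lt_of_le (h.zero_lt_crit k hk)
    (h.strictMonoOn_crit.monotoneOn (by simp; omega) (by simp) (by omega))

/-- Two equioscillating polynomials with the same two leading coefficients coincide. -/
theorem eq_of_equioscillation_of_le {D' : ℝ[X]} {μ' κ' e' : ℕ → ℝ}
    (h : IsBandStructure D m μ κ e) (h' : IsBandStructure D' m μ' κ' e')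
    (hD : D.natDegree = m + 1) (hD' : D'.natDegree = m + 1)
    (htop : D.coeff (m + 1) = D'.coeff (m + 1)) (h0 : D.coeff m = 0) (h0' : D'.coeff m = 0)
    (hosc : ∀ k < m + 2, (-1) ^ (m + 1 - k) * D.eval (κ k) = 1)
    (hosc' : ∀ k < m + 2, (-1) ^ (m + 1 - k) * D'.eval (κ' k) = 1)
    (hle : κ (m + 1) - κ 0 ≤ κ' (m + 1) - κ' 0) : D = D' := by
  -- Translation by `c` aligns the left ends; by `hle` the interval of `D` then falls inside that of
  -- `D'`.
  set c := κ' 0 - κ 0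
  have htaylor : ∀ k, (taylor c D').coeff (m + 1 + k) = D'.coeff (m + 1 + k) := by
    intro k
    rw [taylor_coeff, eq_C_of_natDegree_le_zero (p := hasseDeriv (m + 1 + k) D')
      ((natDegree_hasseDeriv_le _ _).trans (by omega)), eval_C, hasseDeriv_coeff]
    simp
  -- The difference has degree at most `m`, so its divided difference over the `m + 2` nodes `κ`
  -- vanishes. Each summand is nonnegative, because `D` equals `±1` with alternating signs at the
  -- nodes while the translate of `D'` is at most `1` in modulus. Hence the difference vanishes at
  -- all nodes.
  have hr : D - taylor c D' = 0 := by
    have hcoeff : ∀ k, m + 1 ≤ k → (D - taylor c D').coeff k = 0 := by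
      intro k hk
      obtain ⟨j, rfl⟩ := Nat.exists_eq_add_of_le hk
      rw [coeff_sub, htaylor]
      rcases Nat.eq_zero_or_pos j with rfl | hj
      · rw [add_zero, htop, sub_self]
      · rw [coeff_eq_zero_of_natDegree_lt (by omega), coeff_eq_zero_of_natDegree_lt (by omega),
          sub_self]
    have hlag := Lagrange.coeff_eq_sum (s := Finset.range (m + 2)) (v := κ)
      (by simpa using h.strictMonoOn_crit.injOn) (P := D - taylor c D')
      ((degree_lt_iff_coeff_zero _ _).2 fun k hk => hcoeff k (by simp at hk; omega))
    rw [Finset.card_range, hcoeff _ (by omega)] at hlag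
    have hnum : ∀ i < m + 2, 0 ≤ (-1) ^ (m + 1 - i) * (D - taylor c D').eval (κ i) := by
      intro i hi
      rw [eval_sub, mul_sub, hosc i hi, taylor_eval, sub_nonneg]
      have h1 : κ 0 ≤ κ i := h.strictMonoOn_crit.monotoneOn (by simp) (by simpa using hi) (by omega)
      have h2 : κ i ≤ κ (m + 1) :=
        h.strictMonoOn_crit.monotoneOn (by simpa using hi) (by simp) (by omega)
      have h3 := h'.abs_eval_le (C := 1) (fun k hk => (hosc' k hk).le) (t := κ i + c)
        ⟨by simp only [c]; linarith, by simp only [c]; linarith⟩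
      refine (le_abs_self _).trans ?_
      rw [abs_mul]
      simpa using h3
    have hterm : ∀ i ∈ Finset.range (m + 2), 0 ≤ (D - taylor c D').eval (κ i) /
        ∏ j ∈ (Finset.range (m + 2)).erase i, (κ i - κ j) := by
      intro i hi
      rw [Finset.mem_range] at hi
      have h1 := neg_one_pow_mul_prod_erase_pos h.strictMonoOn_crit hi
      have h2 := div_nonneg (hnum i hi) h1.le
      rwa [mul_div_mul_left _ _ (by simp)] at h2
    have hzero := (Finset.sum_eq_zero_iff_of_nonneg hterm).1 hlag.symm
    refine eq_zero_of_coeff_of_eval h.strictMonoOn_crit (fun k hk => hcoeff k (by omega))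
      fun k hk => ?_
    have h1 := neg_one_pow_mul_prod_erase_pos h.strictMonoOn_crit hk
    refine (div_eq_zero_iff.1 (hzero k (Finset.mem_range.2 hk))).resolve_right fun h2 => ?_
    rw [h2, mul_zero] at h1
    exact h1.false
  have hDt : D = taylor c D' := sub_eq_zero.1 hr
  -- A nonzero translation would change the vanishing subleading coefficient.
  have hcm : (taylor c D').coeff m = (m + 1) * D'.coeff (m + 1) * c := by
    rw [taylor_coeff, eval_eq_sum_range' (n := 2) (by
      have := natDegree_hasseDeriv_le D' m; omega), Finset.sum_range_succ, Finset.sum_range_one,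
      hasseDeriv_coeff, hasseDeriv_coeff, zero_add, h0', add_comm 1 m, Nat.choose_succ_self_right]
    push_cast
    ring
  have hne : D'.coeff (m + 1) ≠ 0 := by
    rw [← hD', coeff_natDegree, leadingCoeff_ne_zero]
    rintro rfl
    simp at hD'
  have hc0 : c = 0 := by
    rw [← hDt, h0] at hcm
    have : (m + 1 : ℝ) ≠ 0 := by positivity
    simpa [hne, this] using hcm.symm
  rw [hDt, hc0, taylor_zero]

end IsBandStructure

namespace JacobiData

variable {m : ℕ} [NeZero (m + 1)]

/-- The recurrence is run downwards: comparing top coefficients gives `b`, then `a²`, and positivity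
gives `a`. -/
theorem eq_of_monicPhi_eq {q q' : JacobiData (m + 1)}
    (h1 : q.monicPhi (m + 1) = q'.monicPhi (m + 1))
    (h2 : q.monicPhi (m + 2) = q'.monicPhi (m + 2)) : q = q' := by
  have step : ∀ n, q.monicPhi (n + 1) = q'.monicPhi (n + 1) →
      q.monicPhi (n + 2) = q'.monicPhi (n + 2) → q.b (n + 1 : ℕ) = q'.b (n + 1 : ℕ) ∧
      (0 < n → q.a n = q'.a n ∧ q.monicPhi n = q'.monicPhi n) := by
    intro n h1 h2
    rw [monicPhi, monicPhi, ← h1] at h2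
    have hn : (q.monicPhi n).coeff n = 0 ∧ (q'.monicPhi n).coeff n = 0 := by
      cases n with
      | zero => simp [monicPhi]
      | succ n => exact ⟨q.coeff_monicPhi_of_lt n _ (by omega), q'.coeff_monicPhi_of_lt n _ (by omega)⟩
    have hb : q.b (n + 1 : ℕ) = q'.b (n + 1 : ℕ) := by
      have := congrArg (fun p => p.coeff n) h2
      simp only [sub_mul, coeff_sub, coeff_C_mul, coeff_monicPhi_self, hn] at this
      linarith
    refine ⟨hb, fun hn0 => ?_⟩
    rw [hb] at h2
    have h3 : C (q.a n ^ 2) * q.monicPhi n = C (q'.a n ^ 2) * q'.monicPhi n := by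
      linear_combination -h2
    obtain ⟨n, rfl⟩ := Nat.exists_eq_succ_of_ne_zero hn0.ne'
    simp only [Nat.succ_eq_add_one] at h3 ⊢
    have h4 : q.a (n + 1 : ℕ) ^ 2 = q'.a (n + 1 : ℕ) ^ 2 := by
      have := congrArg (fun p => p.coeff n) h3
      simpa only [coeff_C_mul, coeff_monicPhi_self, mul_one] using this
    have h5 : q.a (n + 1 : ℕ) = q'.a (n + 1 : ℕ) :=
      (pow_left_inj₀ (q.a_pos _).le (q'.a_pos _).le two_ne_zero).1 h4
    rw [← h4] at h3
    exact ⟨h5, mul_left_cancel₀ (C_ne_zero.2 (pow_ne_zero 2 (q.a_ne _))) h3⟩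
  have key : ∀ j ≤ m, q.monicPhi (m - j + 1) = q'.monicPhi (m - j + 1) ∧
      q.monicPhi (m - j + 2) = q'.monicPhi (m - j + 2) := by
    intro j
    induction j with
    | zero => exact fun _ => ⟨h1, h2⟩
    | succ j ih =>
      intro hj
      obtain ⟨h3, h4⟩ := ih (by omega)
      have h5 := step _ h3 h4
      rw [show m - j = m - (j + 1) + 1 by omega] at h5 h3
      exact ⟨(h5.2 (by omega)).2, h3⟩
  have hkey : ∀ n ≤ m, _ := fun n hn => by
    have h3 := key (m - n) (by omega)
    rw [show m - (m - n) = n by omega] at h3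
    exact step n h3.1 h3.2
  rw [← sub_eq_zero]
  refine eq_zero_of_coordinates (fun n hn => ?_) fun n hn0 hn => ?_
  · change bCLM _ (q - q') = 0
    rw [map_sub, sub_eq_zero]
    exact (hkey n hn).1
  · rw [map_sub, sub_eq_zero]
    exact Real.exp_injective ((hkey n hn).2 hn0).1

/-- The Dirichlet eigenvalues and the norming constants determine the Jacobi data. -/
theorem eq_of_dirichletEigenvalue_eq {q q' : JacobiData (m + 1)}
    (hν : ∀ n, q.dirichletEigenvalue n = q'.dirichletEigenvalue n)
    (hψ : ∀ n, q.normingConstant n = q'.normingConstant n) : q = q' := by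
  have hφ : ∀ n, (q.phi (m + 2)).eval (q.dirichletEigenvalue n) =
      (q'.phi (m + 2)).eval (q.dirichletEigenvalue n) := by
    intro n
    have h1 := Real.log_injOn_pos (q.gapSign_mul_phi_pos n) (q'.gapSign_mul_phi_pos n) (hψ n)
    rw [← hν] at h1
    exact mul_left_cancel₀ (by rw [gapSign_eq]; simp) h1
  -- The first polynomial is monic with known zeros; the second is monic without subleading term and
  -- has known values at these `m` points.
  refine eq_of_monicPhi_eq ?_ ?_ <;> rw [← sub_eq_zero] <;>
    refine eq_zero_of_coeff_of_eval_fin q.strictMono_dirichletEigenvalue (fun k hk => ?_) fun n => ?_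
  · rcases (show m ≤ k from hk).eq_or_lt with rfl | hk
    · rw [coeff_sub, coeff_monicPhi_self, coeff_monicPhi_self, sub_self]
    · rw [coeff_sub, q.coeff_monicPhi_of_lt _ k hk, q'.coeff_monicPhi_of_lt _ k hk, sub_self]
  · rw [eval_sub, ← C_prodA_mul_phi, ← C_prodA_mul_phi, eval_mul, eval_mul,
      eval_phi_dirichletEigenvalue, hν, eval_phi_dirichletEigenvalue, mul_zero, mul_zero, sub_self]
  · rcases (show m ≤ k from hk).eq_or_lt with rfl | hk
    · rw [coeff_sub, ← phi_period, ← phi_period, coeff_phi_pred, coeff_phi_pred, sub_self]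
    · rcases (Nat.succ_le_of_lt hk).eq_or_lt with rfl | hk
      · rw [coeff_sub, coeff_monicPhi_self, coeff_monicPhi_self, sub_self]
      · rw [coeff_sub, q.coeff_monicPhi_of_lt _ k hk, q'.coeff_monicPhi_of_lt _ k hk, sub_self]
  · rw [eval_sub, ← phi_period, ← phi_period, hφ, sub_self]

/-- The outermost nodes have height exactly `1`, the others `cosh |ψ_n|`. A general predicate serves
both equioscillation and the bound by `cosh R`. -/
theorem height_crit_eq (q : JacobiData (m + 1)) {μ κ e : ℕ → ℝ}
    (hB : IsBandStructure q.lyapunov m μ κ e)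
    (hn : ∀ n : Fin (m + 1 - 1), q.criticalPoint n = κ (n.val + 1)) {P : ℝ → Prop} (h1 : P 1)
    (hP : ∀ n : Fin (m + 1 - 1), P (Real.cosh (q.slitHeight n))) :
    ∀ k < m + 2, P ((-1) ^ (m + 1 - k) * q.lyapunov.eval (κ k)) := by
  rintro (_ | k) hk
  · rw [Nat.sub_zero, hB.eval_first]; exact h1
  · rw [Nat.add_sub_add_right]
    by_cases hkm : k = m
    · rw [hkm, hB.eval_last]; simpa using h1
    · have := hP ⟨k, by omega⟩
      rwa [cosh_slitHeight, gapSign_eq, hn] at this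

theorem eq_of_marchenkoOstrovsky_eq_zero {q q' : JacobiData (m + 1)}
    (h : q.marchenkoOstrovsky = 0) (h' : q'.marchenkoOstrovsky = 0) : q = q' := by
  have key : ∀ {q : JacobiData (m + 1)}, q.marchenkoOstrovsky = 0 → ∀ n,
      q.slitHeight n = 0 ∧ q.normingConstant n = 0 ∧ q.dirichletEigenvalue n = q.criticalPoint n := by
    intro q h n
    have h1 : q.slitHeight n = 0 := by rw [← norm_marchenkoOstrovsky, h]; simp
    have h2 : q.normingConstant n = 0 := by
      have := q.sq_normingConstant_le n
      rw [h1] at this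
      nlinarith
    refine ⟨h1, h2, ?_⟩
    by_contra hne
    have := q.gapSign_mul_lyapunov_lt n hne
    rw [← cosh_normingConstant, ← cosh_slitHeight, h1, h2] at this
    exact this.false
  obtain ⟨μ, κ, e, hB, hn⟩ := q.exists_bandStructure
  obtain ⟨μ', κ', e', hB', hn'⟩ := q'.exists_bandStructure
  have hosc := q.height_crit_eq hB (fun n => (hn n).2.1) (P := fun x => x = 1) rfl
    fun n => by rw [(key h n).1, Real.cosh_zero]
  have hosc' := q'.height_crit_eq hB' (fun n => (hn' n).2.1) (P := fun x => x = 1) rfl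
    fun n => by rw [(key h' n).1, Real.cosh_zero]
  have hΔ : q.lyapunov = q'.lyapunov := by
    rcases le_total (κ (m + 1) - κ 0) (κ' (m + 1) - κ' 0) with hle | hle
    · exact hB.eq_of_equioscillation_of_le hB' q.natDegree_lyapunov q'.natDegree_lyapunov
        (by rw [coeff_lyapunov_top, coeff_lyapunov_top]) q.coeff_lyapunov_pred
        q'.coeff_lyapunov_pred hosc hosc' hle
    · exact (hB'.eq_of_equioscillation_of_le hB q'.natDegree_lyapunov q.natDegree_lyapunov
        (by rw [coeff_lyapunov_top, coeff_lyapunov_top]) q'.coeff_lyapunov_pred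
        q.coeff_lyapunov_pred hosc' hosc hle).symm
  -- The condition inside `Classical.epsilon` involves `q` only through `Δ`.
  have hcrit : ∀ n, q.criticalPoint n = q'.criticalPoint n := by
    intro n
    refine congrArg Classical.epsilon (funext fun t => ?_)
    simp only [IsGapCriticalPoint, gapLeft, gapRight, bandEdge, hΔ]
  refine eq_of_dirichletEigenvalue_eq (fun n => ?_) fun n => ?_
  · rw [(key h n).2.2, (key h' n).2.2, hcrit]
  · rw [(key h n).2.1, (key h' n).2.1]

end JacobiData

end

/-! ### Global inversion of proper local homeomorphisms. -/

noncomputable section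

open Filter Topology

section Topology

/-- The range is clopen and nonempty, hence everything. The set `S` of values taken twice is open,
by openness of `f` on disjoint neighbourhoods. It is closed, because local injectivity makes the
off-diagonal coincidence set closed and `f × f` is a closed map. It misses `y₀`, so it is empty. -/
theorem IsLocalHomeomorph.bijective_of_isProperMap {X Y : Type*} [TopologicalSpace X] [T2Space X]
    [TopologicalSpace Y] [T2Space Y] [PreconnectedSpace Y] [Nonempty X] {f : X → Y}
    (hf : IsLocalHomeomorph f) (hp : IsProperMap f) {y₀ : Y}
    (h0 : ∀ x x', f x = y₀ → f x' = y₀ → x = x') : Function.Bijective f := by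
  have hsurj : Set.range f = Set.univ := by
    refine (isClopen_iff.1 ⟨hp.isClosedMap.isClosed_range, hf.isOpenMap.isOpen_range⟩).resolve_left ?_
    exact (Set.range_nonempty f).ne_empty
  set S : Set Y := {y | ∃ x x', x ≠ x' ∧ f x = y ∧ f x' = y}
  have hopen : IsOpen S := by
    refine isOpen_iff_mem_nhds.2 ?_
    rintro _ ⟨x, x', hne, rfl, hx'⟩
    obtain ⟨U, V, hU, hV, hxU, hxV, hUV⟩ := t2_separation hne
    have h1 : f '' U ∈ 𝓝 (f x) := hf.isOpenMap.image_mem_nhds (hU.mem_nhds hxU)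
    have h2 : f '' V ∈ 𝓝 (f x) := hx' ▸ hf.isOpenMap.image_mem_nhds (hV.mem_nhds hxV)
    filter_upwards [h1, h2]
    rintro y ⟨u, hu, rfl⟩ ⟨v, hv, hvu⟩
    exact ⟨u, v, fun h => Set.disjoint_left.1 hUV hu (h ▸ hv), rfl, hvu⟩
  have hclosed : IsClosed S := by
    set Z : Set (X × X) := {p | f p.1 = f p.2 ∧ p.1 ≠ p.2}
    have hZ : IsClosed Z := by
      rw [← isOpen_compl_iff, isOpen_iff_mem_nhds]
      rintro ⟨x, x'⟩ hxx
      by_cases hfx : f x = f x'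
      · have : x = x' := by
          by_contra hne
          exact hxx ⟨hfx, hne⟩
        subst this
        obtain ⟨U, hU, hxU, hinj⟩ := hf.isLocallyInjective x
        filter_upwards [(hU.prod hU).mem_nhds ⟨hxU, hxU⟩]
        rintro ⟨u, v⟩ ⟨hu, hv⟩ ⟨h1, h2⟩
        exact h2 (hinj hu hv h1)
      · have h1 : IsOpen {p : X × X | f p.1 ≠ f p.2} :=
          isOpen_ne_fun (hf.continuous.comp continuous_fst) (hf.continuous.comp continuous_snd)
        filter_upwards [h1.mem_nhds hfx]
        rintro ⟨u, v⟩ huv ⟨h2, -⟩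
        exact huv h2
    have h1 : IsClosed (Prod.map f f '' Z) := (hp.prodMap hp).isClosedMap Z hZ
    have h2 : S = (fun y => (y, y)) ⁻¹' (Prod.map f f '' Z) := by
      ext y
      constructor
      · rintro ⟨x, x', hne, h3, h4⟩
        exact ⟨(x, x'), ⟨h3.trans h4.symm, hne⟩, Prod.ext h3 h4⟩
      · rintro ⟨⟨x, x'⟩, ⟨-, hne⟩, h5⟩
        exact ⟨x, x', hne, congrArg Prod.fst h5, congrArg Prod.snd h5⟩
    rw [h2]
    exact h1.preimage (by fun_prop)
  have hS : S = ∅ := by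
    refine (isClopen_iff.1 ⟨hclosed, hopen⟩).resolve_right fun h => ?_
    obtain ⟨x, x', hne, h3, h4⟩ : y₀ ∈ S := h ▸ Set.mem_univ _
    exact hne (h0 x x' h3 h4)
  refine ⟨fun x x' hxx => ?_, Set.range_eq_univ.1 hsurj⟩
  by_contra hne
  have : f x ∈ S := ⟨x, x', hne, rfl, hxx.symm⟩
  rw [hS] at this
  exact this

end Topology

theorem isRealAnalyticIsomorphism_of_proper {E F : Type*} [NormedAddCommGroup E]
    [InnerProductSpace ℝ E] [FiniteDimensional ℝ E] [NormedAddCommGroup F] [InnerProductSpace ℝ F]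
    [FiniteDimensional ℝ F] {f : E → F} (hdim : Module.finrank ℝ E = Module.finrank ℝ F)
    (hf : ∀ x, AnalyticAt ℝ f x) (hinj : ∀ x h, fderiv ℝ f x h = 0 → h = 0)
    (hproper : ∀ R, ∃ K, ∀ x, ‖f x‖ ≤ R → ‖x‖ ≤ K) {y₀ : F}
    (h0 : ∀ x x', f x = y₀ → f x' = y₀ → x = x') : IsRealAnalyticIsomorphism f := by
  have : ProperSpace E := FiniteDimensional.proper_real E
  have : ProperSpace F := FiniteDimensional.proper_real F
  have : CompleteSpace E := FiniteDimensional.complete ℝ E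
  have : CompleteSpace F := FiniteDimensional.complete ℝ F
  have hcont : Continuous f := continuous_iff_continuousAt.2 fun x => (hf x).continuousAt
  -- The exponent `⊤` is the analytic one, so the local inverse obtained below is analytic.
  have hc : ∀ x, ContDiffAt ℝ ⊤ f x := fun x => (hf x).contDiffAt
  have hder : ∀ x, ∃ L : E ≃L[ℝ] F, HasFDerivAt f (L : E →L[ℝ] F) x := by
    intro x
    have hL : Function.Injective (fderiv ℝ f x : E →ₗ[ℝ] F) :=
      (injective_iff_map_eq_zero _).2 (hinj x)
    refine ⟨(LinearMap.linearEquivOfInjective _ hL hdim).toContinuousLinearEquiv, ?_⟩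
    convert! (hf x).differentiableAt.hasFDerivAt
  choose L hL using hder
  have hloc : IsLocalHomeomorph f := IsLocalHomeomorph.mk f fun x =>
    ⟨(hc x).toOpenPartialHomeomorph f (hL x) (by simp),
      (hc x).mem_toOpenPartialHomeomorph_source (hL x) (by simp), fun _ _ => rfl⟩
  have hp : IsProperMap f := by
    refine isProperMap_iff_isCompact_preimage.2 ⟨hcont, fun K hK => ?_⟩
    obtain ⟨R, hR⟩ := hK.isBounded.exists_norm_le
    obtain ⟨B, hB⟩ := hproper R
    refine Metric.isCompact_of_isClosed_isBounded (hK.isClosed.preimage hcont) ?_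
    exact isBounded_iff_forall_norm_le.2 ⟨B, fun x hx => hB x (hR _ hx)⟩
  have hbij := hloc.bijective_of_isProperMap hp h0
  refine ⟨Equiv.ofBijective f hbij, fun _ => rfl, fun x _ => hf x, fun y _ => ?_⟩
  obtain ⟨x, rfl⟩ := hbij.2 y
  refine ((hc x).to_localInverse (hL x) (by simp)).analyticAt.congr ?_
  -- A local right inverse of the bijection `f` coincides with its global inverse.
  have h1 : ∀ᶠ y in 𝓝 (f x), f ((hc x).localInverse (hL x) (by simp) y) = y :=
    ((hc x).hasStrictFDerivAt' (hL x) (by simp)).eventually_right_inverse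
  filter_upwards [h1] with y hy
  exact ((Equiv.ofBijective f hbij).symm_apply_eq.2 hy.symm).symm

theorem coeff_prod_X_sub_C (y : ℕ → ℝ) (n : ℕ) :
    (∏ j ∈ Finset.range (n + 2), (X - C (y j))).coeff n =
      ((∑ j ∈ Finset.range (n + 2), y j) ^ 2 - ∑ j ∈ Finset.range (n + 2), y j ^ 2) / 2 := by
  have h1 : ∀ n, (∏ j ∈ Finset.range (n + 1), (X - C (y j))).coeff n =
      -∑ j ∈ Finset.range (n + 1), y j := fun n => by
    simpa using prod_X_sub_C_coeff_card_pred (Finset.range (n + 1)) y (by simp)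
  induction n with
  | zero =>
    simp only [Finset.prod_range_succ, Finset.prod_range_zero, one_mul, mul_coeff_zero, coeff_sub,
      coeff_X_zero, coeff_C_zero, Finset.sum_range_succ, Finset.sum_range_zero]
    ring
  | succ n ih =>
    rw [Finset.prod_range_succ, mul_comm, coeff_X_sub_C_mul_succ, ih, h1,
      Finset.sum_range_succ _ (n + 2), Finset.sum_range_succ _ (n + 2)]
    ring

/-! ### Properness: bounding the Jacobi data by its image. -/

namespace JacobiData

/-- The Hilbert–Schmidt norm of the Jacobi matrix from a coefficient of the Lyapunov function. -/
theorem sum_sq_eq {n : ℕ} [NeZero (n + 1 + 1)] (q : JacobiData (n + 1 + 1)) :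
    (∑ z, q.b z ^ 2) / 2 + ∑ z, q.a z ^ 2 = -2 * q.lyapunov.coeff n := by
  have h1 := q.coeff_theta n
  have h2 : q.prodA (n + 1) * q.a 0 = 1 := by
    rw [← q.prodA_period, q.prodA_succ (n + 1), a_period]
  have h3 : (q.theta (n + 2)).coeff n = -q.a 0 ^ 2 := by
    refine mul_left_cancel₀ (q.prodA_pos (n + 1)).ne' ?_
    rw [h1, mul_neg, pow_two, ← mul_assoc, h2, one_mul]
  rw [coeff_lyapunov, coeff_monicPhi_pred_pred, h3,
    ZMod.sum_range_natCast_succ fun z : ZMod (n + 1 + 1) => q.b z, sum_b_eq_zero,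
    ZMod.sum_range_natCast_succ fun z : ZMod (n + 1 + 1) => q.b z ^ 2,
    ← ZMod.sum_range_natCast_succ fun z : ZMod (n + 1 + 1) => q.a z ^ 2,
    Finset.sum_range_succ _ (n + 1), a_period]
  ring

variable {m : ℕ} [NeZero (m + 1)]

theorem exists_zeros_bound (R : ℝ) : ∃ K, ∀ q : JacobiData (m + 1), ‖q.marchenkoOstrovsky‖ ≤ R →
    ∃ μ : ℕ → ℝ, q.lyapunov = C (1 / 2) * ∏ j ∈ Finset.range (m + 1), (X - C (μ j)) ∧
      ∑ j ∈ Finset.range (m + 1), μ j = 0 ∧ ∀ k < m + 1, |μ k| ≤ K := by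
  -- This is the length bound of `length_mul_coeff_le`, doubled because the leading coefficient of
  -- `Δ` is `1 / 2`.
  refine ⟨2 * ((m + 1) * (m + 2) * Real.cosh R), fun q hq => ?_⟩
  obtain ⟨μ, κ, e, hB, hn⟩ := q.exists_bandStructure
  have hheight := q.height_crit_eq hB (fun n => (hn n).2.1) (P := fun x => x ≤ Real.cosh R)
    (Real.one_le_cosh _) fun n => by
      rw [Real.cosh_le_cosh, ← norm_marchenkoOstrovsky, abs_norm]
      exact ((PiLp.norm_apply_le _ n).trans hq).trans (le_abs_self _)
  have hκ : κ 0 < κ (m + 1) := hB.strictMonoOn_crit (by simp) (by simp) (by omega)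
  have hlen := length_mul_coeff_le (c := 1 / 2) q.natDegree_lyapunov (Real.cosh_pos R).le hκ
    (fun t ht => hB.abs_eval_le hheight ht) (by norm_num) q.coeff_lyapunov_top.ge
    (by linarith [Real.one_le_cosh R])
  have hfac := eq_C_mul_prod_of_eval hB.strictMonoOn_zero q.natDegree_lyapunov.le hB.eval_zero
  rw [coeff_lyapunov_top] at hfac
  have hsum : ∑ j ∈ Finset.range (m + 1), μ j = 0 := by
    have h1 := q.coeff_lyapunov_pred
    have h2 := prod_X_sub_C_coeff_card_pred (Finset.range (m + 1)) μ (by simp)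
    rw [Finset.card_range, Nat.add_sub_cancel] at h2
    rw [hfac, coeff_C_mul, h2] at h1
    linarith
  -- The zeros sum to `0`, so the interval containing them contains `0` and its length bounds their
  -- moduli.
  have hneg : κ 0 < 0 := by
    by_contra h
    refine (Finset.sum_pos (fun j hj => ?_) ⟨0, by simp⟩).ne' hsum
    exact (not_lt.1 h).trans_lt (hB.first_lt_zero (Finset.mem_range.1 hj))
  have hpos : 0 < κ (m + 1) := by
    by_contra h
    refine (Finset.sum_neg (fun j hj => ?_) ⟨0, by simp⟩).ne hsum
    exact (hB.zero_lt_last (Finset.mem_range.1 hj)).trans_le (not_lt.1 h)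
  refine ⟨μ, hfac, hsum, fun k hk => abs_le.2 ⟨?_, ?_⟩⟩
  · linarith [hB.first_lt_zero hk]
  · linarith [hB.zero_lt_last hk]

theorem norm_le_of_abs_le {q : JacobiData (m + 1)} {K : ℝ}
    (hx : ∀ z, |xCLM z q| ≤ K) (hb : ∀ z, |q.b z| ≤ K) : ‖q‖ ≤ √(2 * ((m + 1) * K ^ 2)) := by
  refine Real.le_sqrt_of_sq_le ?_
  have h : ∀ v : MeanZeroSeq (m + 1), (∀ z, |(v : EuclideanSpace ℝ (ZMod (m + 1))) z| ≤ K) →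
      ‖v‖ ^ 2 ≤ (m + 1) * K ^ 2 := by
    intro v hv
    rw [← Submodule.norm_coe, EuclideanSpace.norm_sq_eq]
    refine (Finset.sum_le_card_nsmul _ _ (K ^ 2) fun z _ => ?_).trans ?_
    · rw [Real.norm_eq_abs]
      gcongr
      exact hv z
    · rw [Finset.card_univ, ZMod.card, nsmul_eq_mul]
      push_cast
      rfl
  rw [WithLp.prod_norm_sq_eq_of_L2]
  linarith [h q.fst hx, h q.snd hb]

theorem finrank_meanZeroSeq : Module.finrank ℝ (MeanZeroSeq (m + 1)) = m := by
  set φ : Module.Dual ℝ (EuclideanSpace ℝ (ZMod (m + 1))) :=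
    { toFun := fun v => ∑ n, v n
      map_add' := fun v w => by simp [Finset.sum_add_distrib]
      map_smul' := fun c v => by simp [Finset.mul_sum] }
  have hker : MeanZeroSeq (m + 1) = LinearMap.ker φ := rfl
  have hne : φ ≠ 0 := by
    intro h
    have h1 := LinearMap.congr_fun h (EuclideanSpace.single 0 1)
    simp [φ] at h1
  have := Module.Dual.finrank_ker_add_one_of_ne_zero hne
  rw [finrank_euclideanSpace, ZMod.card] at this
  rw [hker]
  omega

theorem finrank_jacobiData : Module.finrank ℝ (JacobiData (m + 1)) = m + m := by
  rw [(WithLp.linearEquiv 2 ℝ (MeanZeroSeq (m + 1) × MeanZeroSeq (m + 1))).finrank_eq,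
    Module.finrank_prod, finrank_meanZeroSeq]

theorem finrank_eq : Module.finrank ℝ (JacobiData (m + 1)) =
    Module.finrank ℝ (MOTarget (m + 1)) := by
  rw [finrank_jacobiData, (WithLp.linearEquiv 2 ℝ (Fin (m + 1 - 1) → EuclideanSpace ℝ (Fin 2))).finrank_eq,
    Module.finrank_pi_fintype]
  simp
  ring

/-- By `sum_sq_eq` the quantity `∑ b² / 2 + ∑ a²` is a coefficient of `Δ`, bounded through its
zeros. It controls `b` and bounds each `x_n` above; the zero sum turns the upper bounds into lower
ones. -/
theorem exists_norm_bound (R : ℝ) : ∃ K, ∀ q : JacobiData (m + 1),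
    ‖q.marchenkoOstrovsky‖ ≤ R → ‖q‖ ≤ K := by
  cases m with
  | zero =>
    have := Module.finrank_zero_iff.1 (finrank_jacobiData (m := 0))
    exact ⟨0, fun q _ => by rw [Subsingleton.elim q 0, norm_zero]⟩
  | succ n =>
    obtain ⟨L, hL⟩ := exists_zeros_bound (m := n + 1) R
    set S : ℝ := (n + 2) * L ^ 2
    set A : ℝ := 2 + 2 * S
    -- `A` bounds every `x_n` from above and every `|b_n|`; the factor `n + 2` leaves room for the
    -- lower bound, minus the sum of the other `n + 1` coordinates.
    refine ⟨_, fun q hq => norm_le_of_abs_le (K := (n + 2) * A) ?_ ?_⟩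
    all_goals
      obtain ⟨μ, hμ, hμ0, hμL⟩ := hL q hq
      have hS : (∑ z, q.b z ^ 2) / 2 + ∑ z, q.a z ^ 2 ≤ S := by
        rw [sum_sq_eq, hμ, coeff_C_mul, coeff_prod_X_sub_C, hμ0]
        have : ∑ j ∈ Finset.range (n + 2), μ j ^ 2 ≤ S := by
          refine (Finset.sum_le_card_nsmul _ _ (L ^ 2) fun j hj => ?_).trans ?_
          · rw [← sq_abs]
            gcongr
            exact hμL j (Finset.mem_range.1 hj)
          · rw [Finset.card_range, nsmul_eq_mul]
            push_cast
            rfl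
        have h0 : 0 ≤ ∑ j ∈ Finset.range (n + 2), μ j ^ 2 := Finset.sum_nonneg fun _ _ => sq_nonneg _
        linarith
      have hb0 : 0 ≤ ∑ z, q.b z ^ 2 := Finset.sum_nonneg fun _ _ => sq_nonneg _
      have ha0 : 0 ≤ ∑ z, q.a z ^ 2 := Finset.sum_nonneg fun _ _ => sq_nonneg _
      have hA : 1 ≤ A := by linarith
      have hn0 : (0 : ℝ) ≤ n := Nat.cast_nonneg n
      have hx1 : ∀ z, xCLM z q ≤ A := by
        intro z
        have h1 : q.a z ^ 2 ≤ ∑ z, q.a z ^ 2 :=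
          Finset.single_le_sum (f := fun z => q.a z ^ 2) (fun _ _ => sq_nonneg _)
            (Finset.mem_univ z)
        have h2 : xCLM z q + 1 ≤ q.a z := Real.add_one_le_exp _
        nlinarith [sq_nonneg (q.a z - 1)]
    · intro z
      have hsum : ∑ z, xCLM z q = 0 := q.sum_x_eq_zero
      rw [← Finset.add_sum_erase _ _ (Finset.mem_univ z)] at hsum
      have h1 : ∑ w ∈ Finset.univ.erase z, xCLM w q ≤ (n + 1) * A := by
        refine (Finset.sum_le_card_nsmul _ _ A fun w _ => hx1 w).trans ?_
        rw [Finset.card_erase_of_mem (Finset.mem_univ z), Finset.card_univ, ZMod.card, nsmul_eq_mul]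
        push_cast [Nat.add_sub_cancel]
        rfl
      rw [abs_le]
      constructor
      · nlinarith
      · nlinarith [hx1 z]
    · intro z
      have h1 : q.b z ^ 2 ≤ ∑ z, q.b z ^ 2 :=
        Finset.single_le_sum (f := fun z => q.b z ^ 2) (fun _ _ => sq_nonneg _) (Finset.mem_univ z)
      have h2 : |q.b z| ≤ A := by
        refine abs_le_of_sq_le_sq ?_ (by linarith)
        nlinarith
      nlinarith

end JacobiData

end

theorem theorem1p1 (N : ℕ) [NeZero N] :
    -- the Dirichlet eigenvalues are the zeros of `φ_N`, strictly ordered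
    (∀ q : JacobiData N, StrictMono q.dirichletEigenvalue ∧
      ∀ t : ℝ, (q.phi N).eval t = 0 ↔ ∃ n, q.dirichletEigenvalue n = t) ∧
    -- each closed gap contains exactly one critical point of `Δ`
    (∀ (q : JacobiData N) (n : Fin (N - 1)), ∃! t : ℝ, q.IsGapCriticalPoint n t) ∧
    -- the argument of the logarithm is positive, the radicand is nonnegative
    (∀ (q : JacobiData N) (n : Fin (N - 1)),
      0 < JacobiData.gapSign n * (q.phi (N + 1)).eval (q.dirichletEigenvalue n) ∧
      q.normingConstant n ^ 2 ≤ q.slitHeight n ^ 2) ∧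
    -- the modulus of `ψ_n`
    (∀ (q : JacobiData N) (n : Fin (N - 1)),
      Real.cosh ‖q.marchenkoOstrovsky n‖ =
        JacobiData.gapSign n * q.lyapunov.eval (q.criticalPoint n)) ∧
    IsRealAnalyticIsomorphism (JacobiData.marchenkoOstrovsky (N := N)) := by
  obtain ⟨m, rfl⟩ := Nat.exists_eq_add_one_of_ne_zero (NeZero.ne N)
  refine ⟨fun q => ⟨q.strictMono_dirichletEigenvalue, q.eval_phi_eq_zero_iff⟩,
    fun q n => q.existsUnique_gapCriticalPoint n,
    fun q n => ⟨q.gapSign_mul_phi_pos n, q.sq_normingConstant_le n⟩,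
    fun q n => by rw [q.norm_marchenkoOstrovsky, q.cosh_slitHeight], ?_⟩
  exact isRealAnalyticIsomorphism_of_proper JacobiData.finrank_eq
    JacobiData.analyticAt_marchenkoOstrovsky (fun _ _ => JacobiData.eq_zero_of_fderiv_eq_zero)
    JacobiData.exists_norm_bound (y₀ := 0) fun _ _ => JacobiData.eq_of_marchenkoOstrovsky_eq_zero
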